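/- Let $q\ge 4$ be a prime power, and let $E$ be the set of the $q^2+q+1$ points of the projective plane $\mathbb P^2(\mathbb F_q)$. The Veronese code $C_q\subseteq\mathbb F_q^{E}$ is the linear code with generator matrix $G_q$ of size $6\times(q^2+q+1)$ whose column at the point $P=(x:y:z)\in E$ is a coordinate vector (any fixed one) of the point $(x^2:xy:xz:y^2:yz:z^2)\in\mathbb P^5(\mathbb F_q)$. Let $M_q$ be the matroid on $E$ associated to $C_q$: for a parity check matrix $H$ of $C_q$, a set $X\subseteq E$ is independent iff the columns of $H$ indexed by $X$ are linearly independent over $\mathbb F_q$. For $X\subseteq E$ let $r(X)$ be its rank in $M_q$ and $n(X)=|X|-r(X)$ its nullity, and let $N_i=\{X\subseteq E : n(X)=i\}$. Below, a conic is the zero set in $\mathbb P^2(\mathbb F_q)$ of a nonzero quadratic form over $\mathbb F_q$; it is called irreducible if the form is irreducible over the algebraic closure of $\mathbb F_q$. Lines and pairs of lines are identified with their sets of $\mathbb F_q$-rational points (a pair of lines with the union), and minimal means minimal with respect to inclusion. Then: - The minimal elements of $N_1$ are exactly the complements in $E$ of the $\frac{q(q+1)(q^2+q+1)}{2}$ pairs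 of distinct lines and of the $q^5-q^2$ irreducible conics. - The minimal elements of $N_2$ are exactly the complements of the $q^2(q^2+q+1)$ sets consisting of all points of a line and one point outside of it, and of the $\frac{(q^2+q+1)q^2(q^2+q)(q-1)^2}{24}$ sets of $4$ points no $3$ of which lie on a line. - The minimal elements of $N_3$ are exactly the complements of the $q^2+q+1$ lines and of the $\frac{(q^2+q+1)q^2(q^2+q)}{6}$ sets of $3$ non-collinear points. - The minimal elements of $N_4$ are exactly the complements of the $\frac{(q^2+q+1)(q^2+q)}{2}$ sets of two points. - The minimal elements of $N_5$ are exactly the complements of the $q^2+q+1$ single points. - The only element of $N_6$ is $E$. -/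

import Mathlib

open scoped LinearAlgebra.Projectivization

namespace Veronese

section Matroids

theorem linearIndepOn_augment {K : Type*} [Field K] {r E : Type*} [Finite E]
    (v : E → r → K) {I J : Set E} (hI : LinearIndepOn K v I) (hJ : LinearIndepOn K v J)
    (hlt : I.ncard < J.ncard) : ∃ e ∈ J, e ∉ I ∧ LinearIndepOn K v (insert e I) := by
  classical
  have := Fintype.ofFinite E
  by_contra hcon
  push Not at hcon
  have hsub : Set.range (fun e : J => v e) ≤ Submodule.span K (v '' I) := by
    rintro _ ⟨⟨e, he⟩, rfl⟩
    by_cases heI : e ∈ I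
    · exact Submodule.subset_span ⟨e, heI, rfl⟩
    · by_contra hns
      exact hcon e he heI (hI.insert hns)
  have hcard := linearIndependent_le_span_aux' (fun e : J => v e) hJ (v '' I) hsub
  rw [← Nat.card_eq_fintype_card, ← Nat.card_eq_fintype_card, Nat.card_coe_set_eq,
    Nat.card_coe_set_eq] at hcard
  have := Set.ncard_image_le (f := v) I.toFinite
  omega

/-- The column matroid of a matrix `H` over a field, on the (finite) index set of its columns:
a set of column indices is independent iff the corresponding columns of `H` are
linearly independent (as an indexed family, so that repeated columns are dependent). -/
def columnMatroid {K : Type*} [Field K] {r E : Type*} [Finite E] (H : Matrix r E K) :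
    Matroid E :=
  (IndepMatroid.ofFinite (E := Set.univ) Set.finite_univ
    (fun X => LinearIndepOn K (fun (e : E) (i : r) => H i e) X)
    (linearIndepOn_empty K _)
    (fun _ _ hJ hIJ => hJ.mono hIJ)
    (fun _ _ hI hJ hlt => linearIndepOn_augment _ hI hJ hlt)
    (fun _ _ => Set.subset_univ _)).matroid

/-- The nullity `n(X) = |X| - r(X)` of a set `X` in a matroid on a finite set
(the rank `r(X)` never exceeds `|X|`, so the subtraction does not truncate). -/
noncomputable def nullity {E : Type*} (M : Matroid E) (X : Set E) : ℕ :=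
  X.ncard - (M.eRk X).toNat

/-- The class `N_i` of all subsets of the ground set that have nullity `i`. -/
def nullityClass {E : Type*} (M : Matroid E) (i : ℕ) : Set (Set E) :=
  {X | X ⊆ M.E ∧ nullity M X = i}

/-- The inclusion-minimal elements of `N_i`. -/
def minimalNullitySets {E : Type*} (M : Matroid E) (i : ℕ) : Set (Set E) :=
  {X | Minimal (fun Y => Y ∈ nullityClass M i) X}

end Matroids

section Codes

variable {K : Type*} [Field K]

/-- The linear code with generator matrix `G`: the row space of `G`. -/
def codeOf {k E : Type*} (G : Matrix k E K) : Submodule K (E → K) :=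
  Submodule.span K (Set.range fun i : k => G i)

/-- `H` is a parity check matrix of the code `C`: `C` is the kernel of `H`.
(The rows of `H` may be linearly dependent.) -/
def IsParityCheck {r E : Type*} [Fintype E] (H : Matrix r E K) (C : Submodule K (E → K)) : Prop :=
  ∀ c : E → K, c ∈ C ↔ H.mulVec c = 0

/-- The quadratic Veronese map `(x, y, z) ↦ (x², xy, xz, y², yz, z²)`, on coordinate vectors. -/
def veronese (v : Fin 3 → K) : Fin 6 → K :=
  ![v 0 ^ 2, v 0 * v 1, v 0 * v 2, v 1 ^ 2, v 1 * v 2, v 2 ^ 2]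

/-- `G` is a generator matrix of the Veronese code: its columns are indexed by the points of the
projective plane, and the column at a point `P` is some coordinate `6`-tuple (an arbitrary nonzero
multiple of any given one) of the image of `P` under the Veronese map `ℙ² → ℙ⁵`. -/
def IsVeroneseMatrix (G : Matrix (Fin 6) (ℙ K (Fin 3 → K)) K) : Prop :=
  ∀ P : ℙ K (Fin 3 → K), ∃ c : K, c ≠ 0 ∧ (fun i => G i P) = c • veronese P.rep

end Codes

section Configurations

variable (K : Type*) [Field K]

/-- The lines of the projective plane, as sets of points. -/
def lines : Set (Set (ℙ K (Fin 3 → K))) :=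
  {L | ∃ W : Submodule K (Fin 3 → K), Module.finrank K W = 2 ∧ L = {P | P ∈ W.projectivization}}

/-- The pairs of distinct lines, as sets of points (the unions `L ∪ L'`). -/
def linePairs : Set (Set (ℙ K (Fin 3 → K))) :=
  {S | ∃ L ∈ lines K, ∃ L' ∈ lines K, L ≠ L' ∧ S = L ∪ L'}

/-- The sets of `K`-rational points of the irreducible conics.  A conic is given by a quadratic
form over `K`; it is irreducible if the form does not factor over the algebraic closure of `K`
(so a pair of conjugate lines, with one `K`-rational point, is not irreducible). -/
def irreducibleConics : Set (Set (ℙ K (Fin 3 → K))) :=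
  {S | ∃ F : MvPolynomial (Fin 3) K, F.IsHomogeneous 2 ∧
    Irreducible (MvPolynomial.map (algebraMap K (AlgebraicClosure K)) F) ∧
    S = {P | MvPolynomial.eval P.rep F = 0}}

/-- The sets consisting of all points of a line and one point outside of it. -/
def linesWithPoint : Set (Set (ℙ K (Fin 3 → K))) :=
  {S | ∃ L ∈ lines K, ∃ P, P ∉ L ∧ S = insert P L}

/-- The sets of four points no three of which are collinear. -/
def quadrilaterals : Set (Set (ℙ K (Fin 3 → K))) :=
  {S | S.ncard = 4 ∧ ∀ T ⊆ S, T.ncard = 3 → ¬ Projectivization.IsCollinear T}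

/-- The sets of three non-collinear points. -/
def triangles : Set (Set (ℙ K (Fin 3 → K))) :=
  {S | S.ncard = 3 ∧ ¬ Projectivization.IsCollinear S}

/-- The sets of exactly `m` points. -/
def pointSets (m : ℕ) : Set (Set (ℙ K (Fin 3 → K))) :=
  {S | S.ncard = m}

end Configurations

end Veronese

/-! A linear relation between the columns of `H` indexed by `X` is, after extension by zero, a
codeword supported on `X`. Codewords are the value vectors of ternary quadratic forms at the points,
up to nonzero factors, and a form vanishing at every point is zero. Hence the nullity of `X` is the
dimension of the space of quadratic forms vanishing on the complement of `X` (`nullity_eq_dimVan`).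
Call a set closed if it is the common zero set of the quadratic forms through it. Closing a set does
not change that space of forms, so the minimal sets of nullity `i` are the complements of the closed
sets of dimension `i` (`minimalNullitySets_eq`, `flats`).

A point outside a closed set imposes exactly one new condition, and every closed set of dimension `i
< 6` is the closure of one of dimension `i + 1` with a point added (`exists_of_mem_flats`). Starting
from the empty set in dimension 6, this determines the closed sets of dimensions 5 to 2. Closedness
is shown by separating outside points with pairs of lines; in the other direction, a form with three
zeros on a line vanishes on the whole line.

In dimension 1 a closed set is the zero set of a single form. A conic is geometrically irreducible,
a line pair, a double line, or has just one point (`zeros_cases`). The last two kinds have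
dimensions 3 and 5. An irreducible conic has `q + 1 ≥ 5` points, no three collinear: four of them
leave dimension 2, and a fifth leaves dimension 1. This is where `q ≥ 4` is needed.

Point sets, triangles and quadrilaterals are counted by one-point extensions. Irreducible conics are
counted by summing the number of zeros over all forms, since the other zero sets, and the number of
forms defining each, are known. -/

namespace Veronese

/-! ### Points and lines of the projective plane, with lines given by dual points -/

section PlaneGeometry

variable {K : Type*} [Field K]

/-- The projective plane over `K`. -/
abbrev Plane (K : Type*) [Field K] := ℙ K (Fin 3 → K)

/-- The points of the line with coordinate vector `ℓ`. -/
def pts (ℓ : Plane K) : Set (Plane K) := {P | P ∈ ℓ}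

theorem mem_pts {P ℓ : Plane K} : P ∈ pts ℓ ↔ P.rep ⬝ᵥ ℓ.rep = 0 := by
  rw [pts, Set.mem_ofPred_eq, Configuration.ofField.mem_iff]
  conv_lhs => rw [← P.mk_rep, ← ℓ.mk_rep]
  rw [Projectivization.orthogonal_mk]

theorem mk_mem_pts {v : Fin 3 → K} (hv : v ≠ 0) {ℓ : Plane K} :
    Projectivization.mk K v hv ∈ pts ℓ ↔ v ⬝ᵥ ℓ.rep = 0 := by
  rw [pts, Set.mem_ofPred_eq, Configuration.ofField.mem_iff]
  conv_lhs => rw [← ℓ.mk_rep]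
  rw [Projectivization.orthogonal_mk]

theorem mem_pts_comm {P ℓ : Plane K} : P ∈ pts ℓ ↔ ℓ ∈ pts P := by
  rw [mem_pts, mem_pts, dotProduct_comm]

theorem eq_or_eq_of_mem_pts {P Q ℓ m : Plane K} (h1 : P ∈ pts ℓ) (h2 : Q ∈ pts ℓ)
    (h3 : P ∈ pts m) (h4 : Q ∈ pts m) : P = Q ∨ ℓ = m :=
  Configuration.Nondegenerate.eq_or_eq h1 h2 h3 h4

theorem exists_line_through {P Q : Plane K} (h : P ≠ Q) : ∃ ℓ : Plane K, P ∈ pts ℓ ∧ Q ∈ pts ℓ := by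
  classical
  exact ⟨_, Configuration.HasLines.mkLine_ax (L := Plane K) h⟩

theorem exists_line_not_mem (P : Plane K) : ∃ ℓ : Plane K, P ∉ pts ℓ :=
  Configuration.Nondegenerate.exists_line P

theorem exists_meet {ℓ m : Plane K} (h : ℓ ≠ m) : ∃ P : Plane K, P ∈ pts ℓ ∧ P ∈ pts m := by
  obtain ⟨P, h1, h2⟩ := exists_line_through h
  exact ⟨P, mem_pts_comm.1 h1, mem_pts_comm.1 h2⟩

theorem natCard_plane [Fintype K] :
    Nat.card (Plane K) = Fintype.card K ^ 2 + Fintype.card K + 1 := by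
  rw [Projectivization.card_of_finrank (n := 3) K (Fin 3 → K) (by simp)]
  simp [Finset.sum_range_succ]
  ring

theorem order_plane [Fintype K] [DecidableEq K] :
    Configuration.ProjectivePlane.order (Plane K) (Plane K) = Fintype.card K := by
  have := Fintype.ofFinite (Plane K)
  have h := Configuration.ProjectivePlane.card_points (Plane K) (Plane K)
  rw [← Nat.card_eq_fintype_card, natCard_plane] at h
  nlinarith

theorem ncard_pts [Fintype K] (ℓ : Plane K) : (pts ℓ).ncard = Fintype.card K + 1 := by
  classical
  rw [← order_plane, ← Configuration.ProjectivePlane.pointCount_eq (Plane K) ℓ]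
  rfl

theorem exists_mem_pts_notMem [Fintype K] (ℓ : Plane K) {S : Set (Plane K)}
    (hS : S.ncard ≤ Fintype.card K) : ∃ P ∈ pts ℓ, P ∉ S := by
  refine Set.exists_mem_notMem_of_ncard_lt_ncard ?_ (Set.toFinite _)
  rw [ncard_pts]
  omega

theorem pts_injective : Function.Injective (pts : Plane K → Set (Plane K)) := by
  intro ℓ m h
  by_contra hne
  obtain ⟨P, hP, hP'⟩ := exists_meet hne
  obtain ⟨m', hm'⟩ := exists_line_not_mem P
  have h1 : ℓ ≠ m' := by rintro rfl; exact hm' hP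
  obtain ⟨Q, hQ, hQ'⟩ := exists_meet h1
  rcases eq_or_eq_of_mem_pts hP hQ hP' (h ▸ hQ) with rfl | h2
  · exact hm' hQ'
  · exact hne h2

theorem exists_point_not_mem (ℓ : Plane K) : ∃ P : Plane K, P ∉ pts ℓ :=
  Configuration.Nondegenerate.exists_point ℓ

/-- Through a point there is a line avoiding any other given point. -/
theorem exists_line_separating {P Q : Plane K} (h : P ≠ Q) :
    ∃ ℓ : Plane K, P ∈ pts ℓ ∧ Q ∉ pts ℓ := by
  obtain ⟨ℓ, hP, hQ⟩ := exists_line_through h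
  obtain ⟨R, hR⟩ := exists_point_not_mem ℓ
  obtain ⟨m, hm, hm'⟩ := exists_line_through (show P ≠ R by rintro rfl; exact hR hP)
  refine ⟨m, hm, fun hQm => ?_⟩
  rcases eq_or_eq_of_mem_pts hP hQ hm hQm with rfl | rfl
  · exact h rfl
  · exact hR hm'

theorem mk_eq_iff_exists {v : Fin 3 → K} (hv : v ≠ 0) (P : Plane K) :
    Projectivization.mk K v hv = P ↔ ∃ c : K, c • P.rep = v := by
  conv_lhs => rw [← P.mk_rep]
  rw [Projectivization.mk_eq_mk_iff']

theorem dotProduct_rep_ker_ne (ℓ : Plane K) : dotProductEquiv K (Fin 3) ℓ.rep ≠ 0 := by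
  rw [Ne, LinearEquiv.map_eq_zero_iff]
  exact ℓ.rep_nonzero

/-- The plane of `K ^ 3` whose points are those of the line `ℓ`. -/
noncomputable def lineSpace (ℓ : Plane K) : Submodule K (Fin 3 → K) :=
  LinearMap.ker (dotProductEquiv K (Fin 3) ℓ.rep)

theorem mem_lineSpace {ℓ : Plane K} {v : Fin 3 → K} : v ∈ lineSpace ℓ ↔ v ⬝ᵥ ℓ.rep = 0 := by
  rw [lineSpace, LinearMap.mem_ker, dotProductEquiv_apply_apply, dotProduct_comm]

theorem finrank_lineSpace (ℓ : Plane K) : Module.finrank K (lineSpace ℓ) = 2 := by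
  have h := Module.Dual.finrank_ker_add_one_of_ne_zero (dotProduct_rep_ker_ne ℓ)
  rw [Module.finrank_fin_fun] at h
  change Module.finrank K (lineSpace ℓ) + 1 = 3 at h
  omega

theorem mem_projectivization_iff_rep {W : Submodule K (Fin 3 → K)} {P : Plane K} :
    P ∈ W.projectivization ↔ P.rep ∈ W := by
  conv_lhs => rw [← P.mk_rep]
  rw [Submodule.mk_mem_projectivization_iff]

theorem exists_le_lineSpace {W : Submodule K (Fin 3 → K)} (hW : Module.finrank K W ≤ 2) :
    ∃ ℓ, W ≤ lineSpace ℓ := by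
  have hlt : W < ⊤ := by
    rw [lt_top_iff_ne_top]
    rintro rfl
    rw [finrank_top, Module.finrank_fin_fun] at hW
    omega
  obtain ⟨f, hf, hle⟩ := Submodule.exists_le_ker_of_lt_top W hlt
  obtain ⟨l, rfl⟩ := (dotProductEquiv K (Fin 3)).surjective f
  have hl : l ≠ 0 := by rintro rfl; simp at hf
  refine ⟨Projectivization.mk K l hl, fun v hv => ?_⟩
  have hv' := hle hv
  rw [LinearMap.mem_ker, dotProductEquiv_apply_apply] at hv'
  by_cases hv0 : v = 0
  · rw [hv0]; exact zero_mem _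
  · rw [mem_lineSpace, ← mk_mem_pts hv0, mem_pts_comm, mk_mem_pts hl]
    obtain ⟨c, hc⟩ := (mk_eq_iff_exists hv0 _).1 rfl
    by_contra hne
    have hc0 : c ≠ 0 := by rintro rfl; exact hv0 (by rw [← hc, zero_smul])
    rw [← hc, dotProduct_smul, smul_eq_mul] at hv'
    exact (mul_ne_zero hc0 hne) hv'

/-- A two-dimensional subspace is the kernel of a nonzero functional, so lines can be parametrized
by points of the dual plane and the incidence axioms become available. -/
theorem mem_lines_iff {S : Set (Plane K)} : S ∈ lines K ↔ ∃ ℓ, S = pts ℓ := by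
  constructor
  · rintro ⟨W, hW, rfl⟩
    obtain ⟨ℓ, hℓ⟩ := exists_le_lineSpace hW.le
    have heq : W = lineSpace ℓ :=
      Submodule.eq_of_le_of_finrank_eq hℓ (hW.trans (finrank_lineSpace ℓ).symm)
    refine ⟨ℓ, Set.ext fun P => ?_⟩
    rw [Set.mem_ofPred_eq, mem_projectivization_iff_rep, heq, mem_lineSpace, mem_pts]
  · rintro ⟨ℓ, rfl⟩
    refine ⟨lineSpace ℓ, finrank_lineSpace ℓ, Set.ext fun P => ?_⟩
    rw [Set.mem_ofPred_eq, mem_projectivization_iff_rep, mem_lineSpace, mem_pts]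

theorem isCollinear_iff {S : Set (Plane K)} : Projectivization.IsCollinear S ↔ ∃ ℓ, S ⊆ pts ℓ := by
  constructor
  · rintro ⟨M, -, hM, hS⟩
    obtain ⟨ℓ, hℓ⟩ := exists_le_lineSpace hM
    refine ⟨ℓ, fun P hP => ?_⟩
    have h := hS hP
    rw [SetLike.mem_coe, ← P.mk_rep, ← Projectivization.Subspace.mem_submodule_iff] at h
    exact mem_pts.2 (mem_lineSpace.1 (hℓ h))
  · rintro ⟨ℓ, hℓ⟩
    refine ⟨(lineSpace ℓ).projectivization, inferInstance, ?_, fun P hP => ?_⟩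
    · rw [show Projectivization.Subspace.submodule (lineSpace ℓ).projectivization = lineSpace ℓ from
        OrderIso.apply_symm_apply _ _, finrank_lineSpace]
    · rw [SetLike.mem_coe, mem_projectivization_iff_rep, mem_lineSpace, ← mem_pts]
      exact hℓ hP

theorem linearIndependent_rep_pair {P Q : Plane K} (h : P ≠ Q) :
    LinearIndependent K ![P.rep, Q.rep] := by
  rw [LinearIndependent.pair_iff' P.rep_nonzero]
  intro a ha
  apply h
  have := (mk_eq_iff_exists Q.rep_nonzero P).2 ⟨a, ha⟩
  rw [← this, Q.mk_rep]

/-- A point of the line through `P` and `Q` is a combination of `P` and `Q`. -/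
theorem exists_rep_eq_combination {P Q R ℓ : Plane K} (h : P ≠ Q) (hP : P ∈ pts ℓ)
    (hQ : Q ∈ pts ℓ) (hR : R ∈ pts ℓ) : ∃ x y : K, R.rep = x • P.rep + y • Q.rep := by
  have hle : Submodule.span K (Set.range ![P.rep, Q.rep]) ≤ lineSpace ℓ := by
    rw [Submodule.span_le]
    rintro _ ⟨i, rfl⟩
    fin_cases i
    · exact mem_lineSpace.2 (mem_pts.1 hP)
    · exact mem_lineSpace.2 (mem_pts.1 hQ)
  have heq := Submodule.eq_of_le_of_finrank_eq hle (by
    rw [finrank_lineSpace, finrank_span_eq_card (linearIndependent_rep_pair h), Fintype.card_fin])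
  have hm : R.rep ∈ lineSpace ℓ := mem_lineSpace.2 (mem_pts.1 hR)
  rw [← heq, Matrix.range_cons, Matrix.range_cons, Matrix.range_empty, Set.union_empty,
    Set.singleton_union, Submodule.mem_span_pair] at hm
  obtain ⟨x, y, hxy⟩ := hm
  exact ⟨x, y, hxy.symm⟩

end PlaneGeometry
-- Quadratic forms vanishing on point sets, and the closure operator they define
section Forms

variable {K : Type*} [Field K]

/-- The value at `v` of the ternary quadratic form with coefficient vector `a`. -/
def qf (a : Fin 6 → K) (v : Fin 3 → K) : K := a ⬝ᵥ veronese v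

theorem qf_eq (a : Fin 6 → K) (v : Fin 3 → K) :
    qf a v = a 0 * v 0 ^ 2 + a 1 * (v 0 * v 1) + a 2 * (v 0 * v 2) + a 3 * v 1 ^ 2 +
      a 4 * (v 1 * v 2) + a 5 * v 2 ^ 2 := by
  simp [qf, veronese, dotProduct, Fin.sum_univ_six]

theorem qf_smul (a : Fin 6 → K) (c : K) (v : Fin 3 → K) : qf a (c • v) = c ^ 2 * qf a v := by
  simp only [qf_eq, Pi.smul_apply, smul_eq_mul]
  ring

theorem qf_smul_left (a : Fin 6 → K) (c : K) (v : Fin 3 → K) : qf (c • a) v = c * qf a v := by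
  simp [qf]

/-- The polar form of a quadratic form. -/
def polar (a : Fin 6 → K) (v w : Fin 3 → K) : K := qf a (v + w) - qf a v - qf a w

theorem qf_combination (a : Fin 6 → K) (v w : Fin 3 → K) (x y : K) :
    qf a (x • v + y • w) = x ^ 2 * qf a v + y ^ 2 * qf a w + x * y * polar a v w := by
  simp only [polar, qf_eq, Pi.add_apply, Pi.smul_apply, smul_eq_mul]
  ring

/-- The coefficient vector of the product of two linear forms. -/
def lineMul (l m : Fin 3 → K) : Fin 6 → K :=
  ![l 0 * m 0, l 0 * m 1 + l 1 * m 0, l 0 * m 2 + l 2 * m 0, l 1 * m 1, l 1 * m 2 + l 2 * m 1,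
    l 2 * m 2]

theorem qf_lineMul (l m v : Fin 3 → K) : qf (lineMul l m) v = (v ⬝ᵥ l) * (v ⬝ᵥ m) := by
  simp [qf_eq, lineMul, dotProduct, Fin.sum_univ_three]
  ring

/-- The points of the conic with coefficient vector `a`. -/
def zeros (a : Fin 6 → K) : Set (Plane K) := {P | qf a P.rep = 0}

theorem mem_zeros {a : Fin 6 → K} {P : Plane K} : P ∈ zeros a ↔ qf a P.rep = 0 := Iff.rfl

theorem zeros_lineMul (ℓ m : Plane K) : zeros (lineMul ℓ.rep m.rep) = pts ℓ ∪ pts m := by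
  ext P
  rw [mem_zeros, qf_lineMul, mul_eq_zero, Set.mem_union, mem_pts, mem_pts]

theorem zeros_smul {c : K} (hc : c ≠ 0) (a : Fin 6 → K) : zeros (c • a) = zeros a := by
  ext P
  rw [mem_zeros, mem_zeros, qf_smul_left, mul_eq_zero, or_iff_right hc]

/-- The quadratic forms vanishing on a set of points. -/
def vanishing (S : Set (Plane K)) : Submodule K (Fin 6 → K) where
  carrier := {a | ∀ P ∈ S, qf a P.rep = 0}
  add_mem' := fun ha hb P hP => by
    have h1 := ha P hP
    have h2 := hb P hP
    simp only [qf] at h1 h2 ⊢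
    rw [add_dotProduct, h1, h2, add_zero]
  zero_mem' := fun P _ => by simp [qf]
  smul_mem' := fun c a ha P hP => by rw [qf_smul_left, ha P hP, mul_zero]

theorem mem_vanishing {S : Set (Plane K)} {a : Fin 6 → K} : a ∈ vanishing S ↔ S ⊆ zeros a := Iff.rfl

theorem vanishing_anti {S T : Set (Plane K)} (h : S ⊆ T) : vanishing T ≤ vanishing S :=
  fun _ ha => h.trans ha

/-- The dimension of the space of quadratic forms vanishing on a set of points. -/
noncomputable def dimVan (S : Set (Plane K)) : ℕ := Module.finrank K (vanishing S)

/-- The common zeros of all quadratic forms vanishing on a set of points. -/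
def hull (S : Set (Plane K)) : Set (Plane K) := {P | ∀ a ∈ vanishing S, P ∈ zeros a}

theorem subset_hull (S : Set (Plane K)) : S ⊆ hull S := fun _ hP _ ha => mem_vanishing.1 ha hP

theorem vanishing_hull (S : Set (Plane K)) : vanishing (hull S) = vanishing S :=
  le_antisymm (vanishing_anti (subset_hull S)) fun a ha _ hP => hP a ha

theorem hull_hull (S : Set (Plane K)) : hull (hull S) = hull S := by
  rw [hull, vanishing_hull, ← hull]

theorem dimVan_hull (S : Set (Plane K)) : dimVan (hull S) = dimVan S := by
  rw [dimVan, vanishing_hull, dimVan]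

theorem hull_mono {S T : Set (Plane K)} (h : S ⊆ T) : hull S ⊆ hull T :=
  fun _ hP a ha => hP a (vanishing_anti h ha)

theorem hull_subset_iff {S T : Set (Plane K)} (hT : hull T = T) : hull S ⊆ T ↔ S ⊆ T :=
  ⟨(subset_hull S).trans, fun h => hT ▸ hull_mono h⟩

theorem hull_zeros (a : Fin 6 → K) : hull (zeros a) = zeros a :=
  (subset_hull _).antisymm' fun _ hP => hP a (mem_vanishing.2 subset_rfl)

/-- Evaluation of quadratic forms at a point. -/
noncomputable def evalAt (P : Plane K) : (Fin 6 → K) →ₗ[K] K where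
  toFun a := qf a P.rep
  map_add' a b := by simp [qf]
  map_smul' c a := by simp [qf]

/-- Evaluation at `P` is a nonzero functional on `vanishing S` exactly because `P` is outside the
hull, and its kernel consists of the forms that also vanish at `P`. -/
theorem dimVan_insert {S : Set (Plane K)} {P : Plane K} (hP : P ∉ hull S) :
    dimVan (insert P S) + 1 = dimVan S := by
  let f : Module.Dual K (vanishing S) := (evalAt P).domRestrict (vanishing S)
  have hf : f ≠ 0 := fun h => hP fun a ha => LinearMap.congr_fun h ⟨a, ha⟩
  have : LinearMap.range ((vanishing S).subtype.comp (LinearMap.ker f).subtype) =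
      vanishing (insert P S) := by
    ext a
    constructor
    · rintro ⟨⟨⟨b, hb⟩, hb'⟩, rfl⟩
      exact Set.insert_subset hb' hb
    · intro ha
      exact ⟨⟨⟨a, (Set.subset_insert _ _).trans ha⟩, mem_vanishing.1 ha (Set.mem_insert _ _)⟩, rfl⟩
  rw [dimVan, dimVan, ← Module.Dual.finrank_ker_add_one_of_ne_zero hf, ← this,
    LinearMap.finrank_range_of_inj (Subtype.val_injective.comp Subtype.val_injective)]

theorem dimVan_empty : dimVan (∅ : Set (Plane K)) = 6 := by
  have : vanishing (∅ : Set (Plane K)) = ⊤ := top_unique fun _ _ => Set.empty_subset _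
  rw [dimVan, this, finrank_top, Module.finrank_fin_fun]

/-- The sets of points cut out by quadratic forms for which the space of vanishing quadratic
forms has dimension `i`. -/
def flats (K : Type*) [Field K] (i : ℕ) : Set (Set (Plane K)) := {S | hull S = S ∧ dimVan S = i}

/-- The forms through `T` are among those through `S`; the dimension bound makes the two spaces
equal, hence also the hulls. -/
theorem eq_hull_of_subset {S T : Set (Plane K)} (hT : hull T = T) (h : S ⊆ T)
    (hd : dimVan S ≤ dimVan T) : hull S = T := by
  rw [← hT, hull, hull, Submodule.eq_of_le_of_finrank_le (vanishing_anti h) hd]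

theorem hull_insert_mem_flats {i : ℕ} {T : Set (Plane K)} (hT : T ∈ flats K (i + 1)) {P : Plane K}
    (hP : P ∉ T) : hull (insert P T) ∈ flats K i := by
  refine ⟨hull_hull _, ?_⟩
  rw [dimVan_hull]
  have := dimVan_insert (hT.1.symm ▸ hP)
  rw [hT.2] at this
  omega

theorem insert_mem_flats {i : ℕ} {T : Set (Plane K)} (hT : T ∈ flats K (i + 1)) {P : Plane K}
    (hP : P ∉ T) (h : hull (insert P T) = insert P T) : insert P T ∈ flats K i :=
  h ▸ hull_insert_mem_flats hT hP

/-- The induction step of the classification. Take `T` maximal among the subsets of `S` of dimension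
greater than `i`. It equals its hull by maximality, and adding any further point of `S` brings the
dimension down to at most `i`; since one point costs exactly one, `T` has dimension `i + 1`. -/
theorem exists_of_mem_flats [Finite (Plane K)] {i : ℕ} (hi : i < 6) {S : Set (Plane K)}
    (hS : S ∈ flats K i) : ∃ T ∈ flats K (i + 1), ∃ P, P ∉ T ∧ S = hull (insert P T) := by
  obtain ⟨T, ⟨hTS, hTi⟩, hmax⟩ := Set.Finite.exists_maximal
    (s := {T : Set (Plane K) | T ⊆ S ∧ i < dimVan T}) (Set.toFinite _)
    ⟨∅, Set.empty_subset _, by rw [dimVan_empty]; exact hi⟩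
  have hne : T ≠ S := by rintro rfl; exact hTi.ne' hS.2
  obtain ⟨P, hPS, hPT⟩ := Set.exists_of_ssubset (hTS.ssubset_of_ne hne)
  have hflat : hull T = T :=
    (subset_hull T).antisymm' <| hmax ⟨(hull_subset_iff hS.1).2 hTS, by rwa [dimVan_hull]⟩
      (subset_hull T)
  have hle : dimVan (insert P T) ≤ i := by
    by_contra! hlt
    exact hPT (hmax ⟨Set.insert_subset hPS hTS, hlt⟩ (Set.subset_insert P T) (Set.mem_insert P T))
  have h1 := dimVan_insert (hflat.symm ▸ hPT)
  refine ⟨T, ⟨hflat, by omega⟩, P, hPT, ?_⟩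
  exact (eq_hull_of_subset hS.1 (Set.insert_subset hPS hTS) (hle.trans hS.2.ge)).symm

/-- A set is cut out by quadratic forms if it can be separated by pairs of lines from every
point outside of it. -/
theorem hull_eq_of_lines {S : Set (Plane K)} (h : ∀ X ∉ S, ∃ ℓ m : Plane K,
    S ⊆ pts ℓ ∪ pts m ∧ X ∉ pts ℓ ∧ X ∉ pts m) : hull S = S := by
  refine (subset_hull S).antisymm' fun X hX => ?_
  by_contra hXS
  obtain ⟨ℓ, m, hS, h1, h2⟩ := h X hXS
  rw [← zeros_lineMul] at hS
  have := hX _ hS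
  rw [zeros_lineMul] at this
  exact this.elim h1 h2

/-- A quadratic form vanishing at three points of a line vanishes on the line. -/
theorem pts_subset_zeros {a : Fin 6 → K} {P Q R ℓ : Plane K} (hPQ : P ≠ Q) (hPR : P ≠ R)
    (hQR : Q ≠ R) (hP : P ∈ pts ℓ) (hQ : Q ∈ pts ℓ) (hR : R ∈ pts ℓ) (haP : P ∈ zeros a)
    (haQ : Q ∈ zeros a) (haR : R ∈ zeros a) : pts ℓ ⊆ zeros a := by
  obtain ⟨x, y, hxy⟩ := exists_rep_eq_combination hPQ hP hQ hR
  have hx : x ≠ 0 := by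
    rintro rfl
    apply hQR
    rw [← (mk_eq_iff_exists R.rep_nonzero Q).2 ⟨y, by rw [hxy, zero_smul, zero_add]⟩, R.mk_rep]
  have hy : y ≠ 0 := by
    rintro rfl
    apply hPR
    rw [← (mk_eq_iff_exists R.rep_nonzero P).2 ⟨x, by rw [hxy, zero_smul, add_zero]⟩, R.mk_rep]
  rw [mem_zeros] at haP haQ haR
  rw [hxy, qf_combination, haP, haQ] at haR
  -- On the line the form is `x * y` times the polar value, as it vanishes at `P` and `Q`. The third
  -- zero has both coordinates nonzero, so the polar value is zero.
  have hB : polar a P.rep Q.rep = 0 := by simpa [hx, hy] using haR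
  intro S hS
  obtain ⟨z, w, hzw⟩ := exists_rep_eq_combination hPQ hP hQ hS
  rw [mem_zeros, hzw, qf_combination, haP, haQ, hB]
  ring

theorem pts_subset_hull {S : Set (Plane K)} {P Q R ℓ : Plane K} (hPQ : P ≠ Q) (hPR : P ≠ R)
    (hQR : Q ≠ R) (hP : P ∈ pts ℓ) (hQ : Q ∈ pts ℓ) (hR : R ∈ pts ℓ) (haP : P ∈ S)
    (haQ : Q ∈ S) (haR : R ∈ S) : pts ℓ ⊆ hull S := fun _ hX _ ha =>
  pts_subset_zeros hPQ hPR hQR hP hQ hR (mem_vanishing.1 ha haP) (mem_vanishing.1 ha haQ)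
    (mem_vanishing.1 ha haR) hX

end Forms
-- Closed sets of dimensions 6 to 2
section FlatsOfPoints

variable {K : Type*} [Field K]

/-- Three points that do not lie on a common line. -/
def NonCollinear (A B C : Plane K) : Prop := ∀ ℓ, A ∈ pts ℓ → B ∈ pts ℓ → C ∉ pts ℓ

theorem NonCollinear.rotate {A B C : Plane K} (h : NonCollinear A B C) : NonCollinear B C A :=
  fun ℓ hB hC hA => h ℓ hA hB hC

theorem NonCollinear.swap {A B C : Plane K} (h : NonCollinear A B C) : NonCollinear B A C :=
  fun ℓ hB hA => h ℓ hA hB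

/-- Two sides of a triangle meet only in their common vertex. -/
theorem NonCollinear.eq_of_mem {A B C X ℓ m : Plane K} (h : NonCollinear A B C) (hA : A ∈ pts ℓ)
    (hB : B ∈ pts ℓ) (hA' : A ∈ pts m) (hC : C ∈ pts m) (hX : X ∈ pts ℓ) (hX' : X ∈ pts m) :
    X = A := by
  rcases eq_or_eq_of_mem_pts hX hA hX' hA' with h1 | rfl
  · exact h1
  · exact absurd hC (h ℓ hA hB)

theorem mem_triangles_iff {S : Set (Plane K)} : S ∈ triangles K ↔
    ∃ A B C, A ≠ B ∧ A ≠ C ∧ B ≠ C ∧ NonCollinear A B C ∧ S = {A, B, C} := by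
  constructor
  · rintro ⟨hS, hcol⟩
    obtain ⟨A, B, C, hAB, hAC, hBC, rfl⟩ := Set.ncard_eq_three.1 hS
    refine ⟨A, B, C, hAB, hAC, hBC, fun ℓ hA hB hC => hcol (isCollinear_iff.2 ⟨ℓ, ?_⟩), rfl⟩
    rintro X (rfl | rfl | rfl) <;> assumption
  · rintro ⟨A, B, C, hAB, hAC, hBC, h, rfl⟩
    refine ⟨Set.ncard_eq_three.2 ⟨A, B, C, hAB, hAC, hBC, rfl⟩, fun hcol => ?_⟩
    obtain ⟨ℓ, hℓ⟩ := isCollinear_iff.1 hcol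
    exact h ℓ (hℓ (by simp)) (hℓ (by simp)) (hℓ (by simp))

/-- Adding a point to a triangle gives a quadrilateral iff it is on none of the sides. -/
theorem insert_mem_quadrilaterals_iff {A B C D : Plane K} (hAB : A ≠ B) (hAC : A ≠ C)
    (hBC : B ≠ C) (hDA : D ≠ A) (hDB : D ≠ B) (hDC : D ≠ C) :
    {D, A, B, C} ∈ quadrilaterals K ↔
      NonCollinear A B C ∧ NonCollinear A B D ∧ NonCollinear A C D ∧ NonCollinear B C D := by
  have key : ∀ X Y Z : Plane K, X ≠ Y → X ≠ Z → Y ≠ Z → {X, Y, Z} ⊆ ({D, A, B, C} : Set (Plane K)) →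
      {D, A, B, C} ∈ quadrilaterals K → NonCollinear X Y Z := by
    intro X Y Z h1 h2 h3 hsub hq ℓ hX hY hZ
    refine hq.2 _ hsub (Set.ncard_eq_three.2 ⟨X, Y, Z, h1, h2, h3, rfl⟩) (isCollinear_iff.2 ⟨ℓ, ?_⟩)
    rintro W (rfl | rfl | rfl) <;> assumption
  constructor
  · intro h
    refine ⟨key A B C hAB hAC hBC ?_ h, key A B D hAB hDA.symm hDB.symm ?_ h,
      key A C D hAC hDA.symm hDC.symm ?_ h, key B C D hBC hDB.symm hDC.symm ?_ h⟩ <;>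
    · rintro W (rfl | rfl | rfl) <;> simp
  · rintro ⟨h1, h2, h3, h4⟩
    refine ⟨?_, fun T hT hT3 hcol => ?_⟩
    · rw [Set.ncard_insert_of_notMem (by simp [hDA, hDB, hDC]),
        Set.ncard_eq_three.2 ⟨A, B, C, hAB, hAC, hBC, rfl⟩]
    · obtain ⟨ℓ, hℓ⟩ := isCollinear_iff.1 hcol
      have hS4 : ({D, A, B, C} : Set (Plane K)).ncard = 4 := by
        rw [Set.ncard_insert_of_notMem (by simp [hDA, hDB, hDC]),
          Set.ncard_eq_three.2 ⟨A, B, C, hAB, hAC, hBC, rfl⟩]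
      have hd := Set.ncard_sdiff_add_ncard_of_subset hT
      rw [hT3, hS4] at hd
      -- A collinear triple omits exactly one of the four points; each choice of the omitted point
      -- contradicts one of the four hypotheses.
      obtain ⟨W, hW⟩ := Set.ncard_eq_one.1 (show (({D, A, B, C} : Set (Plane K)) \ T).ncard = 1 by omega)
      have hmem : ∀ X ∈ ({D, A, B, C} : Set (Plane K)), X ≠ W → X ∈ pts ℓ := by
        intro X hX hXW
        by_contra hXℓ
        exact hXW (hW.subset ⟨hX, fun hXT => hXℓ (hℓ hXT)⟩)
      have hWS : W ∈ ({D, A, B, C} : Set (Plane K)) := (hW.symm.subset rfl).1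
      rcases hWS with rfl | rfl | rfl | rfl
      · exact h1 ℓ (hmem _ (by simp) hDA.symm) (hmem _ (by simp) hDB.symm)
          (hmem _ (by simp) hDC.symm)
      · exact h4 ℓ (hmem _ (by simp) hAB.symm) (hmem _ (by simp) hAC.symm) (hmem _ (by simp) hDA)
      · exact h3 ℓ (hmem _ (by simp) hAB) (hmem _ (by simp) hBC.symm) (hmem _ (by simp) hDB)
      · exact h2 ℓ (hmem _ (by simp) hAC) (hmem _ (by simp) hBC) (hmem _ (by simp) hDC)

theorem mem_quadrilaterals_iff {S : Set (Plane K)} : S ∈ quadrilaterals K ↔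
    ∃ A B C D, A ≠ B ∧ A ≠ C ∧ B ≠ C ∧ D ≠ A ∧ D ≠ B ∧ D ≠ C ∧ NonCollinear A B C ∧
      NonCollinear A B D ∧ NonCollinear A C D ∧ NonCollinear B C D ∧ S = {D, A, B, C} := by
  constructor
  · intro hS
    have hfin : S.Finite := Set.finite_of_ncard_ne_zero (by rw [hS.1]; norm_num)
    obtain ⟨D, T, hDT, rfl, hT⟩ := (Set.ncard_eq_succ hfin).1 hS.1
    obtain ⟨A, B, C, hAB, hAC, hBC, rfl⟩ := Set.ncard_eq_three.1 hT
    simp only [Set.mem_insert_iff, Set.mem_singleton_iff, not_or] at hDT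
    obtain ⟨hDA, hDB, hDC⟩ := hDT
    obtain ⟨h1, h2, h3, h4⟩ := (insert_mem_quadrilaterals_iff hAB hAC hBC hDA hDB hDC).1 hS
    exact ⟨A, B, C, D, hAB, hAC, hBC, hDA, hDB, hDC, h1, h2, h3, h4, rfl⟩
  · rintro ⟨A, B, C, D, hAB, hAC, hBC, hDA, hDB, hDC, h1, h2, h3, h4, rfl⟩
    exact (insert_mem_quadrilaterals_iff hAB hAC hBC hDA hDB hDC).2 ⟨h1, h2, h3, h4⟩

theorem hull_empty : hull (∅ : Set (Plane K)) = ∅ :=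
  hull_eq_of_lines fun X _ => by
    obtain ⟨ℓ, hℓ⟩ := exists_line_not_mem X
    exact ⟨ℓ, ℓ, Set.empty_subset _, hℓ, hℓ⟩

theorem hull_singleton (P : Plane K) : hull {P} = {P} :=
  hull_eq_of_lines fun X hX => by
    obtain ⟨ℓ, hP, hℓ⟩ := exists_line_separating (Ne.symm hX)
    exact ⟨ℓ, ℓ, by simpa using hP, hℓ, hℓ⟩

theorem hull_pair (P Q : Plane K) : hull {P, Q} = {P, Q} :=
  hull_eq_of_lines fun X hX => by
    simp only [Set.mem_insert_iff, Set.mem_singleton_iff, not_or] at hX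
    obtain ⟨ℓ, hP, hℓ⟩ := exists_line_separating (Ne.symm hX.1)
    obtain ⟨m, hQ, hm⟩ := exists_line_separating (Ne.symm hX.2)
    exact ⟨ℓ, m, by rintro Y (rfl | rfl) <;> simp [hP, hQ], hℓ, hm⟩

theorem hull_pts_union_pts (ℓ m : Plane K) : hull (pts ℓ ∪ pts m) = pts ℓ ∪ pts m := by
  rw [← zeros_lineMul, hull_zeros]

theorem hull_pts (ℓ : Plane K) : hull (pts ℓ) = pts ℓ := by
  simpa using hull_pts_union_pts ℓ ℓ

theorem hull_insert_pts (P ℓ : Plane K) : hull (insert P (pts ℓ)) = insert P (pts ℓ) :=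
  hull_eq_of_lines fun X hX => by
    simp only [Set.mem_insert_iff, not_or] at hX
    obtain ⟨m, hP, hm⟩ := exists_line_separating (Ne.symm hX.1)
    refine ⟨ℓ, m, Set.insert_subset (Or.inr hP) Set.subset_union_left, hX.2, hm⟩

/-- A point off the side `AB` is separated by `AB` and a line through `C`. A point on `AB` other
than `A` is off the side `AC`, so `AC` and a line through `B` serve instead. -/
theorem hull_triangle {A B C : Plane K} (hAB : A ≠ B) (hAC : A ≠ C) (h : NonCollinear A B C) :
    hull {A, B, C} = {A, B, C} :=
  hull_eq_of_lines fun X hX => by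
    simp only [Set.mem_insert_iff, Set.mem_singleton_iff, not_or] at hX
    obtain ⟨hXA, hXB, hXC⟩ := hX
    obtain ⟨ℓ, hA, hB⟩ := exists_line_through hAB
    obtain ⟨m, hA', hC⟩ := exists_line_through hAC
    by_cases hℓ : X ∈ pts ℓ
    · obtain ⟨n, hn, hn'⟩ := exists_line_separating (Ne.symm hXB)
      refine ⟨m, n, ?_, fun hm => hXA (h.eq_of_mem hA hB hA' hC hℓ hm), hn'⟩
      rintro Y (rfl | rfl | rfl) <;> simp [*]
    · obtain ⟨n, hn, hn'⟩ := exists_line_separating (Ne.symm hXC)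
      refine ⟨ℓ, n, ?_, hℓ, hn'⟩
      rintro Y (rfl | rfl | rfl) <;> simp [*]

/-- The line pairs `AB, DC` and `AC, DB` of opposite sides have only the four vertices in common, so
one of them misses any other point. -/
theorem hull_quadrilateral {A B C D : Plane K} (hAB : A ≠ B) (hAC : A ≠ C)
    (hDB : D ≠ B) (hDC : D ≠ C) (h1 : NonCollinear A B C)
    (h2 : NonCollinear A B D) (h3 : NonCollinear A C D) (h4 : NonCollinear B C D) :
    hull {D, A, B, C} = {D, A, B, C} :=
  hull_eq_of_lines fun X hX => by
    simp only [Set.mem_insert_iff, Set.mem_singleton_iff, not_or] at hX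
    obtain ⟨hXD, hXA, hXB, hXC⟩ := hX
    obtain ⟨ab, ab1, ab2⟩ := exists_line_through hAB
    obtain ⟨ac, ac1, ac2⟩ := exists_line_through hAC
    obtain ⟨db, db1, db2⟩ := exists_line_through hDB
    obtain ⟨dc, dc1, dc2⟩ := exists_line_through hDC
    by_cases h : X ∈ pts ab ∨ X ∈ pts dc
    · refine ⟨ac, db, by rintro Y (rfl | rfl | rfl | rfl) <;> simp [*], ?_, ?_⟩
      · intro hac
        rcases h with h | h
        · exact hXA (h1.eq_of_mem ab1 ab2 ac1 ac2 h hac)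
        · exact hXC (h3.swap.eq_of_mem ac2 ac1 dc2 dc1 hac h)
      · intro hdb
        rcases h with h | h
        · exact hXB (h2.swap.eq_of_mem ab2 ab1 db2 db1 h hdb)
        · exact hXD (h4.rotate.rotate.eq_of_mem db1 db2 dc1 dc2 hdb h)
    · rw [not_or] at h
      exact ⟨ab, dc, by rintro Y (rfl | rfl | rfl | rfl) <;> simp [*], h.1, h.2⟩

theorem flats_six : flats K 6 = {∅} := by
  ext S
  constructor
  · rintro ⟨h1, h2⟩
    rw [Set.mem_singleton_iff, ← hull_empty]
    rw [← h1]
    exact (eq_hull_of_subset (h1.symm ▸ h1 : hull S = S) (Set.empty_subset S)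
      (by rw [dimVan_empty, h2])).symm ▸ h1
  · rintro rfl
    exact ⟨hull_empty, dimVan_empty⟩

theorem hull_collinear {A B C ℓ : Plane K} (hAB : A ≠ B) (hAC : A ≠ C) (hBC : B ≠ C)
    (hA : A ∈ pts ℓ) (hB : B ∈ pts ℓ) (hC : C ∈ pts ℓ) : hull {A, B, C} = pts ℓ := by
  apply Set.Subset.antisymm
  · rw [hull_subset_iff (hull_pts ℓ)]
    rintro X (rfl | rfl | rfl) <;> assumption
  · exact pts_subset_hull hAB hAC hBC hA hB hC (by simp) (by simp) (by simp)

theorem mem_linesWithPoint_iff {S : Set (Plane K)} :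
    S ∈ linesWithPoint K ↔ ∃ ℓ P, P ∉ pts ℓ ∧ S = insert P (pts ℓ) := by
  constructor
  · rintro ⟨L, hL, P, hP, rfl⟩
    obtain ⟨ℓ, rfl⟩ := mem_lines_iff.1 hL
    exact ⟨ℓ, P, hP, rfl⟩
  · rintro ⟨ℓ, P, hP, rfl⟩
    exact ⟨pts ℓ, mem_lines_iff.2 ⟨ℓ, rfl⟩, P, hP, rfl⟩

/-- The flat spanned by three collinear points and a point outside of their line. -/
theorem hull_mem_linesWithPoint {S : Set (Plane K)} {A B C D ℓ : Plane K} (hS : S = {A, B, C, D})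
    (hAB : A ≠ B) (hAC : A ≠ C) (hBC : B ≠ C) (hA : A ∈ pts ℓ) (hB : B ∈ pts ℓ) (hC : C ∈ pts ℓ)
    (hD : D ∉ pts ℓ) : hull S ∈ linesWithPoint K := by
  refine mem_linesWithPoint_iff.2 ⟨ℓ, D, hD, ?_⟩
  subst hS
  apply Set.Subset.antisymm
  · rw [hull_subset_iff (hull_insert_pts D ℓ)]
    rintro X (rfl | rfl | rfl | rfl) <;> simp [*]
  · exact Set.insert_subset (subset_hull _ (by simp))
      (pts_subset_hull hAB hAC hBC hA hB hC (by simp) (by simp) (by simp))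

variable [Fintype K]

theorem flats_five : flats K 5 = pointSets K 1 := by
  have h6 : (∅ : Set (Plane K)) ∈ flats K 6 := ⟨hull_empty, dimVan_empty⟩
  ext S
  constructor
  · intro hS
    obtain ⟨T, hT, P, -, rfl⟩ := exists_of_mem_flats (by norm_num) hS
    rw [flats_six] at hT
    obtain rfl := hT
    rw [insert_empty_eq, hull_singleton]
    exact Set.ncard_singleton P
  · intro hS
    obtain ⟨P, rfl⟩ := Set.ncard_eq_one.1 hS
    have := hull_insert_mem_flats h6 (Set.notMem_empty P)
    rwa [insert_empty_eq, hull_singleton] at this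

theorem flats_four : flats K 4 = pointSets K 2 := by
  ext S
  constructor
  · intro hS
    obtain ⟨T, hT, P, hP, rfl⟩ := exists_of_mem_flats (by norm_num) hS
    rw [flats_five] at hT
    obtain ⟨Q, rfl⟩ := Set.ncard_eq_one.1 hT
    rw [hull_pair]
    exact Set.ncard_pair hP
  · intro hS
    obtain ⟨P, Q, hPQ, rfl⟩ := Set.ncard_eq_two.1 hS
    have hT : {Q} ∈ flats K 5 := by
      rw [flats_five]
      exact Set.ncard_singleton Q
    exact insert_mem_flats hT hPQ (hull_pair P Q)

theorem pair_mem_flats {P Q : Plane K} (h : P ≠ Q) : {P, Q} ∈ flats K 4 := by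
  rw [flats_four]
  exact Set.ncard_pair h

theorem exists_three_mem_pts (ℓ : Plane K) :
    ∃ A B C, A ≠ B ∧ A ≠ C ∧ B ≠ C ∧ A ∈ pts ℓ ∧ B ∈ pts ℓ ∧ C ∈ pts ℓ := by
  have h : 2 < (pts ℓ).ncard := by
    rw [ncard_pts]
    have := Fintype.one_lt_card (α := K)
    omega
  obtain ⟨A, B, C, h1, h2, h3, h4, h5, h6⟩ := (Set.two_lt_ncard_iff (Set.toFinite _)).1 h
  exact ⟨A, B, C, h4, h5, h6, h1, h2, h3⟩

theorem pts_mem_flats (ℓ : Plane K) : pts ℓ ∈ flats K 3 := by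
  obtain ⟨A, B, C, hAB, hAC, hBC, hA, hB, hC⟩ := exists_three_mem_pts ℓ
  rw [← hull_collinear hAB hAC hBC hA hB hC]
  exact hull_insert_mem_flats (pair_mem_flats hBC) (by simp [hAB, hAC])

theorem triangle_mem_flats {A B C : Plane K} (hAB : A ≠ B) (hAC : A ≠ C) (hBC : B ≠ C)
    (h : NonCollinear A B C) : {A, B, C} ∈ flats K 3 :=
  insert_mem_flats (pair_mem_flats hBC) (by simp [hAB, hAC]) (hull_triangle hAB hAC h)

theorem flats_three : flats K 3 = lines K ∪ triangles K := by
  ext S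
  constructor
  · intro hS
    obtain ⟨T, hT, A, hA, rfl⟩ := exists_of_mem_flats (by norm_num) hS
    rw [flats_four] at hT
    obtain ⟨B, C, hBC, rfl⟩ := Set.ncard_eq_two.1 hT
    simp only [Set.mem_insert_iff, Set.mem_singleton_iff, not_or] at hA
    by_cases h : NonCollinear A B C
    · right
      rw [hull_triangle hA.1 hA.2 h]
      exact mem_triangles_iff.2 ⟨A, B, C, hA.1, hA.2, hBC, h, rfl⟩
    · left
      simp only [NonCollinear, not_forall, not_not] at h
      obtain ⟨ℓ, h1, h2, h3⟩ := h
      exact mem_lines_iff.2 ⟨ℓ, hull_collinear hA.1 hA.2 hBC h1 h2 h3⟩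
  · rintro (hS | hS)
    · obtain ⟨ℓ, rfl⟩ := mem_lines_iff.1 hS
      exact pts_mem_flats ℓ
    · obtain ⟨A, B, C, hAB, hAC, hBC, h, rfl⟩ := mem_triangles_iff.1 hS
      exact triangle_mem_flats hAB hAC hBC h

theorem insert_pts_mem_flats {P ℓ : Plane K} (h : P ∉ pts ℓ) : insert P (pts ℓ) ∈ flats K 2 :=
  insert_mem_flats (pts_mem_flats ℓ) h (hull_insert_pts P ℓ)

theorem quadrilaterals_subset_flats : quadrilaterals K ⊆ flats K 2 := by
  intro S hS
  obtain ⟨A, B, C, D, hAB, hAC, hBC, hDA, hDB, hDC, h1, h2, h3, h4, rfl⟩ :=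
    mem_quadrilaterals_iff.1 hS
  exact insert_mem_flats (triangle_mem_flats hAB hAC hBC h1) (by simp [*])
    (hull_quadrilateral hAB hAC hDB hDC h1 h2 h3 h4)

/-- A point added to a triangle either lies on a side, and then the closure is that line with the
opposite vertex, or completes a quadrilateral. A point added to a line changes nothing else. -/
theorem flats_two : flats K 2 = linesWithPoint K ∪ quadrilaterals K := by
  ext S
  constructor
  · intro hS
    obtain ⟨T, hT, D, hD, rfl⟩ := exists_of_mem_flats (by norm_num) hS
    rw [flats_three] at hT
    rcases hT with hT | hT
    · obtain ⟨ℓ, rfl⟩ := mem_lines_iff.1 hT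
      left
      exact mem_linesWithPoint_iff.2 ⟨ℓ, D, hD, hull_insert_pts D ℓ⟩
    · obtain ⟨A, B, C, hAB, hAC, hBC, h, rfl⟩ := mem_triangles_iff.1 hT
      simp only [Set.mem_insert_iff, Set.mem_singleton_iff, not_or] at hD
      obtain ⟨hDA, hDB, hDC⟩ := hD
      by_cases h2 : NonCollinear A B D
      swap
      · simp only [NonCollinear, not_forall, not_not] at h2
        obtain ⟨ℓ, g1, g2, g3⟩ := h2
        exact Or.inl (hull_mem_linesWithPoint rfl hDA hDB hAB g3 g1 g2 (h ℓ g1 g2))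
      by_cases h3 : NonCollinear A C D
      swap
      · simp only [NonCollinear, not_forall, not_not] at h3
        obtain ⟨ℓ, g1, g2, g3⟩ := h3
        refine Or.inl (hull_mem_linesWithPoint (D := B) ?_ hDA hDC hAC g3 g1 g2
          fun hB => h ℓ g1 hB g2)
        rw [Set.pair_comm B C]
      by_cases h4 : NonCollinear B C D
      swap
      · simp only [NonCollinear, not_forall, not_not] at h4
        obtain ⟨ℓ, g1, g2, g3⟩ := h4
        refine Or.inl (hull_mem_linesWithPoint (D := A) ?_ hDB hDC hBC g3 g1 g2
          fun hA => h ℓ hA g1 g2)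
        rw [Set.insert_comm A B, Set.pair_comm A C]
      right
      rw [hull_quadrilateral hAB hAC hDB hDC h h2 h3 h4]
      exact (insert_mem_quadrilaterals_iff hAB hAC hBC hDA hDB hDC).2 ⟨h, h2, h3, h4⟩
  · rintro (hS | hS)
    · obtain ⟨ℓ, P, hP, rfl⟩ := mem_linesWithPoint_iff.1 hS
      exact insert_pts_mem_flats hP
    · exact quadrilaterals_subset_flats hS

end FlatsOfPoints
-- Quadratic forms as polynomials, and irreducibility over an extension field
section Polynomials

open MvPolynomial

variable {K : Type*} [Field K]

/-- The ternary quadratic form with coefficient vector `a`, as a polynomial. -/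
noncomputable def formPoly (a : Fin 6 → K) : MvPolynomial (Fin 3) K :=
  C (a 0) * X 0 ^ 2 + C (a 1) * (X 0 * X 1) + C (a 2) * (X 0 * X 2) + C (a 3) * X 1 ^ 2 +
    C (a 4) * (X 1 * X 2) + C (a 5) * X 2 ^ 2

/-- The ternary linear form with coefficient vector `l`, as a polynomial. -/
noncomputable def linPoly (l : Fin 3 → K) : MvPolynomial (Fin 3) K :=
  C (l 0) * X 0 + C (l 1) * X 1 + C (l 2) * X 2

theorem eval_formPoly (a : Fin 6 → K) (v : Fin 3 → K) : eval v (formPoly a) = qf a v := by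
  simp [formPoly, qf_eq]

theorem eval_linPoly (l v : Fin 3 → K) : eval v (linPoly l) = v ⬝ᵥ l := by
  simp [linPoly, dotProduct, Fin.sum_univ_three]
  ring

theorem formPoly_add (a b : Fin 6 → K) : formPoly (a + b) = formPoly a + formPoly b := by
  simp [formPoly]
  ring

theorem linPoly_add (a b : Fin 3 → K) : linPoly (a + b) = linPoly a + linPoly b := by
  simp [linPoly]
  ring

theorem linPoly_smul (c : K) (a : Fin 3 → K) : linPoly (c • a) = c • linPoly a := by
  simp [linPoly, smul_eq_C_mul]
  ring

theorem formPoly_lineMul (l m : Fin 3 → K) : formPoly (lineMul l m) = linPoly l * linPoly m := by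
  simp [formPoly, linPoly, lineMul]
  ring

theorem isHomogeneous_formPoly (a : Fin 6 → K) : (formPoly a).IsHomogeneous 2 := by
  have h : ∀ (c : K) (i j : Fin 3), (C c * (X i * X j) : MvPolynomial (Fin 3) K).IsHomogeneous 2 :=
    fun c i j => ((isHomogeneous_X K i).mul (isHomogeneous_X K j)).C_mul c
  simp only [formPoly, sq]
  exact (((((h _ _ _).add (h _ _ _)).add (h _ _ _)).add (h _ _ _)).add (h _ _ _)).add (h _ _ _)

theorem exists_eq_linPoly {F : MvPolynomial (Fin 3) K} (hF : F.IsHomogeneous 1) :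
    ∃ l, F = linPoly l := by
  rw [← mem_homogeneousSubmodule, homogeneousSubmodule_one_eq_span_X] at hF
  induction hF using Submodule.span_induction with
  | mem x hx =>
    obtain ⟨i, rfl⟩ := hx
    refine ⟨Pi.single i 1, ?_⟩
    fin_cases i <;> simp [linPoly]
  | zero => exact ⟨0, by simp [linPoly]⟩
  | add x y _ _ hx hy =>
    obtain ⟨a, rfl⟩ := hx
    obtain ⟨b, rfl⟩ := hy
    exact ⟨a + b, (linPoly_add a b).symm⟩
  | smul c x _ hx =>
    obtain ⟨a, rfl⟩ := hx
    exact ⟨c • a, (linPoly_smul c a).symm⟩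

/-- The quadratic forms are spanned by products of two linear forms, for which the coefficients are
explicit. -/
theorem exists_eq_formPoly {F : MvPolynomial (Fin 3) K} (hF : F.IsHomogeneous 2) :
    ∃ a, F = formPoly a := by
  rw [← mem_homogeneousSubmodule, ← homogeneousSubmodule_one_pow, sq] at hF
  induction hF using Submodule.mul_induction_on' with
  | mem_mul_mem x hx y hy =>
    obtain ⟨l, rfl⟩ := exists_eq_linPoly hx
    obtain ⟨m, rfl⟩ := exists_eq_linPoly hy
    exact ⟨lineMul l m, (formPoly_lineMul l m).symm⟩
  | add x _ y _ hx hy =>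
    obtain ⟨a, rfl⟩ := hx
    obtain ⟨b, rfl⟩ := hy
    exact ⟨a + b, (formPoly_add a b).symm⟩

theorem map_formPoly {L : Type*} [Field L] (f : K →+* L) (a : Fin 6 → K) :
    map f (formPoly a) = formPoly (f ∘ a) := by
  simp [formPoly]

theorem qf_map {L : Type*} [Field L] (f : K →+* L) (a : Fin 6 → K) (v : Fin 3 → K) :
    qf (f ∘ a) (f ∘ v) = f (qf a v) := by
  simp [qf_eq]

/-- A quadratic form over an extension field is determined by its values on the vectors with
coordinates in the base field. -/
theorem eq_of_qf_eq {L : Type*} [Field L] (f : K →+* L) {a b : Fin 6 → L}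
    (h : ∀ v : Fin 3 → K, qf a (f ∘ v) = qf b (f ∘ v)) : a = b := by
  have h1 := h ![1, 0, 0]
  have h2 := h ![0, 1, 0]
  have h3 := h ![0, 0, 1]
  have h4 := h ![1, 1, 0]
  have h5 := h ![1, 0, 1]
  have h6 := h ![0, 1, 1]
  simp [qf_eq] at h1 h2 h3 h4 h5 h6
  rw [h1, h2] at h4
  rw [h1, h3] at h5
  rw [h2, h3] at h6
  ext i
  fin_cases i
  · exact h1
  · simpa using h4
  · simpa using h5
  · exact h2
  · simpa using h6
  · exact h3

theorem eq_of_forall_qf_eq {a b : Fin 6 → K} (h : ∀ v, qf a v = qf b v) : a = b :=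
  eq_of_qf_eq (RingHom.id K) h

/-- A quadratic form over `K` that is a product of two linear forms over an extension field,
as a function on `K ^ 3`. -/
def Splits {L : Type*} [Field L] (f : K →+* L) (a : Fin 6 → K) : Prop :=
  ∃ l m : Fin 3 → L, ∀ v : Fin 3 → K, f (qf a v) = ((f ∘ v) ⬝ᵥ l) * ((f ∘ v) ⬝ᵥ m)

theorem not_isUnit_linPoly (l : Fin 3 → K) : ¬ IsUnit (linPoly l) := by
  intro h
  have := h.map (eval (0 : Fin 3 → K))
  rw [eval_linPoly, zero_dotProduct] at this
  exact not_isUnit_zero this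

theorem not_irreducible_of_splits {L : Type*} [Field L] (f : K →+* L) {a : Fin 6 → K}
    (h : Splits f a) : ¬ Irreducible (map f (formPoly a)) := by
  obtain ⟨l, m, h⟩ := h
  have : f ∘ a = lineMul l m := eq_of_qf_eq f fun v => by rw [qf_map, h, qf_lineMul]
  rw [map_formPoly, this, formPoly_lineMul]
  intro hirr
  exact (hirr.isUnit_or_isUnit rfl).elim (not_isUnit_linPoly l) (not_isUnit_linPoly m)

theorem exists_eq_C_add_linPoly {F : MvPolynomial (Fin 3) K} (hF : F.totalDegree = 1) :
    ∃ c l, F = C c + linPoly l := by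
  have h := sum_homogeneousComponent F
  rw [hF, Finset.sum_range_succ, Finset.sum_range_one, homogeneousComponent_zero] at h
  obtain ⟨l, hl⟩ := exists_eq_linPoly (homogeneousComponent_isHomogeneous 1 F)
  exact ⟨_, l, by rw [← h, hl]⟩

/-- The constant terms of affine factors can be dropped: comparing the values at `0`, `v` and `t •
v` eliminates the terms of degree 0 and 1 in `t`, leaving a multiple `t * (t - 1)` of the claim.
Hence some `t` other than 0 and 1 is needed. -/
theorem qf_eq_mul_of_forall_eq [Infinite K] {a : Fin 6 → K} {l m : Fin 3 → K} {c d : K}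
    (h : ∀ v, qf a v = (c + v ⬝ᵥ l) * (d + v ⬝ᵥ m)) (v : Fin 3 → K) :
    qf a v = (v ⬝ᵥ l) * (v ⬝ᵥ m) := by
  classical
  obtain ⟨t, ht⟩ := Infinite.exists_notMem_finset ({0, 1} : Finset K)
  simp only [Finset.mem_insert, Finset.mem_singleton, not_or] at ht
  have h0 := h (0 : Fin 3 → K)
  have h1 := h v
  have h2 := h (t • v)
  rw [qf_smul, smul_dotProduct, smul_dotProduct, smul_eq_mul, smul_eq_mul] at h2
  rw [zero_dotProduct, zero_dotProduct, ← zero_smul K (0 : Fin 3 → K), qf_smul] at h0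
  have h3 : t * (t - 1) * (qf a v - (v ⬝ᵥ l) * (v ⬝ᵥ m)) = 0 := by
    linear_combination h2 - t * h1 - (1 - t) * h0
  rw [mul_eq_zero, mul_eq_zero, sub_eq_zero, sub_eq_zero] at h3
  tauto

/-- The degrees of two factors add up to 2. A factor of degree 0 is a unit, and two factors of
degree 1 give a splitting once their constant terms are dropped. -/
theorem irreducible_of_not_splits {L : Type*} [Field L] [Infinite L] (f : K →+* L) {a : Fin 6 → K}
    (h : ¬ Splits f a) : Irreducible (map f (formPoly a)) := by
  have ha : f ∘ a ≠ 0 := by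
    intro h0
    refine h ⟨0, 0, fun v => ?_⟩
    rw [← qf_map, h0]
    simp [qf]
  have hne : formPoly (f ∘ a) ≠ 0 := by
    intro h0
    apply ha
    refine eq_of_forall_qf_eq fun v => ?_
    rw [← eval_formPoly, h0]
    simp [qf]
  rw [map_formPoly]
  refine ⟨fun hu => ?_, fun {x y} hxy => ?_⟩
  · have := hu.map (eval (0 : Fin 3 → L))
    rw [eval_formPoly, qf_eq] at this
    simp at this
  · have hx : x ≠ 0 := by rintro rfl; exact hne (by rw [hxy, zero_mul])
    have hy : y ≠ 0 := by rintro rfl; exact hne (by rw [hxy, mul_zero])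
    have hdeg := totalDegree_mul_of_isDomain hx hy
    rw [← hxy, (isHomogeneous_formPoly _).totalDegree hne] at hdeg
    have hunit : ∀ z : MvPolynomial (Fin 3) L, z ≠ 0 → z.totalDegree = 0 → IsUnit z := by
      intro z hz h0
      rw [totalDegree_eq_zero_iff_eq_C] at h0
      rw [h0] at hz ⊢
      exact (IsUnit.mk0 _ fun hc => hz (by rw [hc, C_0])).map C
    by_cases hx0 : x.totalDegree = 0
    · exact Or.inl (hunit x hx hx0)
    by_cases hy0 : y.totalDegree = 0
    · exact Or.inr (hunit y hy hy0)
    exfalso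
    obtain ⟨c, l, rfl⟩ := exists_eq_C_add_linPoly (show x.totalDegree = 1 by omega)
    obtain ⟨d, m, rfl⟩ := exists_eq_C_add_linPoly (show y.totalDegree = 1 by omega)
    refine h ⟨l, m, fun v => ?_⟩
    rw [← qf_map]
    refine qf_eq_mul_of_forall_eq (c := c) (d := d) (fun w => ?_) _
    rw [← eval_formPoly, hxy]
    simp [eval_linPoly]

/-- A conic whose equation does not split into linear factors over the algebraic closure. -/
def IsIrred (a : Fin 6 → K) : Prop := ¬ Splits (algebraMap K (AlgebraicClosure K)) a

theorem IsIrred.ne_zero {a : Fin 6 → K} (h : IsIrred a) : a ≠ 0 := by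
  rintro rfl
  exact h ⟨0, 0, fun v => by simp [qf]⟩

theorem not_isIrred_lineMul (l m : Fin 3 → K) : ¬ IsIrred (lineMul l m) := by
  refine not_not.2 ⟨algebraMap K _ ∘ l, algebraMap K _ ∘ m, fun v => ?_⟩
  rw [qf_lineMul, map_mul]
  simp [dotProduct]

theorem mem_irreducibleConics_iff {S : Set (Plane K)} :
    S ∈ irreducibleConics K ↔ ∃ a, IsIrred a ∧ S = zeros a := by
  constructor
  · rintro ⟨F, hF, hirr, rfl⟩
    obtain ⟨a, rfl⟩ := exists_eq_formPoly hF
    refine ⟨a, fun h => not_irreducible_of_splits _ h hirr, ?_⟩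
    ext P
    rw [Set.mem_ofPred_eq, eval_formPoly, mem_zeros]
  · rintro ⟨a, ha, rfl⟩
    refine ⟨formPoly a, isHomogeneous_formPoly a, irreducible_of_not_splits _ ha, ?_⟩
    ext P
    rw [Set.mem_ofPred_eq, eval_formPoly, mem_zeros]

end Polynomials
-- Reducible conics, tangents and singular points
section ConicsOverAField

variable {K : Type*} [Field K]

theorem lineMul_add (l m n : Fin 3 → K) : lineMul l (m + n) = lineMul l m + lineMul l n := by
  ext i
  fin_cases i <;> simp [lineMul] <;> ring

theorem lineMul_smul (c : K) (l m : Fin 3 → K) : lineMul l (c • m) = c • lineMul l m := by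
  ext i
  fin_cases i <;> simp [lineMul] <;> ring

theorem eq_zero_of_lineMul_eq_zero {l m : Fin 3 → K} (hl : l ≠ 0) (h : lineMul l m = 0) :
    m = 0 := by
  obtain ⟨i, hi⟩ := Function.ne_iff.1 hl
  have h0 := congrFun h 0
  have h1 := congrFun h 1
  have h2 := congrFun h 2
  have h3 := congrFun h 3
  have h4 := congrFun h 4
  have h5 := congrFun h 5
  simp [lineMul] at h0 h1 h2 h3 h4 h5
  ext j
  fin_cases i <;> simp at hi <;> simp [hi] at h0 h1 h2 h3 h4 h5 <;> fin_cases j <;>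
    simp_all

/-- Multiplication of linear forms by a fixed linear form. -/
def lineMulMap (l : Fin 3 → K) : (Fin 3 → K) →ₗ[K] (Fin 6 → K) where
  toFun := lineMul l
  map_add' := lineMul_add l
  map_smul' c := lineMul_smul c l

/-- A dimension count replaces division: the multiples of the linear form of `ℓ` are a
three-dimensional subspace of the forms vanishing on `ℓ`, and that space has dimension 3. -/
theorem exists_lineMul_of_pts_subset [Fintype K] {a : Fin 6 → K} {ℓ : Plane K}
    (h : pts ℓ ⊆ zeros a) : ∃ m, a = lineMul ℓ.rep m := by
  have hinj : Function.Injective (lineMulMap ℓ.rep) := by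
    rw [← LinearMap.ker_eq_bot, LinearMap.ker_eq_bot']
    exact fun m => eq_zero_of_lineMul_eq_zero ℓ.rep_nonzero
  have hle : LinearMap.range (lineMulMap ℓ.rep) ≤ vanishing (pts ℓ) := by
    rintro _ ⟨m, rfl⟩ P hP
    change qf (lineMul ℓ.rep m) P.rep = 0
    rw [qf_lineMul, mem_pts.1 hP, zero_mul]
  have hd : Module.finrank K (vanishing (pts ℓ)) = 3 := (pts_mem_flats ℓ).2
  have heq := Submodule.eq_of_le_of_finrank_eq hle (by
    rw [hd, LinearMap.finrank_range_of_inj hinj, Module.finrank_fin_fun])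
  have ha : a ∈ vanishing (pts ℓ) := h
  rw [← heq] at ha
  obtain ⟨m, hm⟩ := ha
  exact ⟨m, hm.symm⟩

/-- A conic containing a line is a line pair or a double line. -/
theorem exists_eq_smul_lineMul [Fintype K] {a : Fin 6 → K} (ha : a ≠ 0) {ℓ : Plane K}
    (h : pts ℓ ⊆ zeros a) : ∃ (m : Plane K) (c : K), c ≠ 0 ∧ a = c • lineMul ℓ.rep m.rep := by
  obtain ⟨m, rfl⟩ := exists_lineMul_of_pts_subset h
  have hm : m ≠ 0 := by
    rintro rfl
    exact ha ((lineMulMap ℓ.rep).map_zero)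
  obtain ⟨c, hc⟩ := (mk_eq_iff_exists hm _).1 rfl
  refine ⟨Projectivization.mk K m hm, c, ?_, by rw [← lineMul_smul, hc]⟩
  rintro rfl
  exact hm (by rw [← hc, zero_smul])

theorem not_isIrred_of_pts_subset [Fintype K] {a : Fin 6 → K} {ℓ : Plane K}
    (h : pts ℓ ⊆ zeros a) : ¬ IsIrred a := by
  obtain ⟨m, rfl⟩ := exists_lineMul_of_pts_subset h
  exact not_isIrred_lineMul _ _

/-- The coefficients of the tangent line at a point of a conic. -/
def tangent (a : Fin 6 → K) (p : Fin 3 → K) : Fin 3 → K :=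
  ![2 * a 0 * p 0 + a 1 * p 1 + a 2 * p 2, a 1 * p 0 + 2 * a 3 * p 1 + a 4 * p 2,
    a 2 * p 0 + a 4 * p 1 + 2 * a 5 * p 2]

theorem polar_eq (a : Fin 6 → K) (p v : Fin 3 → K) : polar a p v = v ⬝ᵥ tangent a p := by
  simp [polar, qf_eq, tangent, dotProduct, Fin.sum_univ_three]
  ring

theorem polar_self (a : Fin 6 → K) (p : Fin 3 → K) : polar a p p = 2 * qf a p := by
  simp [polar, qf_eq]
  ring

theorem qf_add_smul (a : Fin 6 → K) (v p : Fin 3 → K) (t : K) :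
    qf a (v + t • p) = qf a v + t ^ 2 * qf a p + t * (v ⬝ᵥ tangent a p) := by
  rw [← polar_eq]
  simp [polar, qf_eq]
  ring

theorem exists_binary_factorization {L : Type*} [Field L] [IsAlgClosed L] (α β γ : L) :
    ∃ s t s' t' : L, ∀ y z : L,
      α * y ^ 2 + β * (y * z) + γ * z ^ 2 = (s * y + t * z) * (s' * y + t' * z) := by
  by_cases hα : α = 0
  · exact ⟨0, 1, β, γ, fun y z => by rw [hα]; ring⟩
  · obtain ⟨r, hr⟩ := IsAlgClosed.exists_root
      (Polynomial.C α * Polynomial.X ^ 2 + Polynomial.C β * Polynomial.X + Polynomial.C γ)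
      (by rw [Polynomial.degree_quadratic hα]; norm_num)
    rw [Polynomial.IsRoot.def] at hr
    simp only [Polynomial.eval_add, Polynomial.eval_mul, Polynomial.eval_C, Polynomial.eval_pow,
      Polynomial.eval_X] at hr
    refine ⟨1, -r, α, β + α * r, fun y z => ?_⟩
    linear_combination z ^ 2 * hr

theorem splits_of_binary {L : Type*} [Field L] [IsAlgClosed L] (f : K →+* L) {a : Fin 6 → K}
    {y z : Fin 3 → K} {α β γ : K}
    (h : ∀ v, qf a v = α * (v ⬝ᵥ y) ^ 2 + β * ((v ⬝ᵥ y) * (v ⬝ᵥ z)) + γ * (v ⬝ᵥ z) ^ 2) :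
    Splits f a := by
  obtain ⟨s, t, s', t', hst⟩ := exists_binary_factorization (f α) (f β) (f γ)
  refine ⟨s • (f ∘ y) + t • (f ∘ z), s' • (f ∘ y) + t' • (f ∘ z), fun v => ?_⟩
  have hd : ∀ w : Fin 3 → K, (f ∘ v) ⬝ᵥ (f ∘ w) = f (v ⬝ᵥ w) := fun w => by simp [dotProduct]
  simp only [dotProduct_add, dotProduct_smul, hd, smul_eq_mul]
  rw [← hst, h]
  simp

/-- A conic with a singular point is a cone over a binary form, hence splits. -/
theorem splits_of_tangent_eq_zero {L : Type*} [Field L] [IsAlgClosed L] (f : K →+* L)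
    {a : Fin 6 → K} {p : Fin 3 → K} (hp : p ≠ 0) (hap : qf a p = 0) (ht : tangent a p = 0) :
    Splits f a := by
  have hinv : ∀ v t, qf a v = qf a (v + t • p) := fun v t => by
    rw [qf_add_smul, hap, ht, dotProduct_zero]
    ring
  obtain ⟨i, hi⟩ := Function.ne_iff.1 hp
  rw [Pi.zero_apply] at hi
  fin_cases i <;> simp at hi
  -- The form is invariant under translation by multiples of `p`. Moving `v` to first coordinate
  -- zero leaves a binary form in the other two coordinates, which are `v ⬝ᵥ y` and `v ⬝ᵥ z`; the
  -- other two cases are analogous.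
  · refine splits_of_binary f (y := ![-p 1 / p 0, 1, 0]) (z := ![-p 2 / p 0, 0, 1])
      (α := a 3) (β := a 4) (γ := a 5) fun v => ?_
    rw [hinv v (-v 0 / p 0)]
    simp [qf_eq, dotProduct, Fin.sum_univ_three]
    field_simp
    ring
  · refine splits_of_binary f (y := ![1, -p 0 / p 1, 0]) (z := ![0, -p 2 / p 1, 1])
      (α := a 0) (β := a 2) (γ := a 5) fun v => ?_
    rw [hinv v (-v 1 / p 1)]
    simp [qf_eq, dotProduct, Fin.sum_univ_three]
    field_simp
    ring
  · refine splits_of_binary f (y := ![1, 0, -p 0 / p 2]) (z := ![0, 1, -p 1 / p 2])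
      (α := a 0) (β := a 1) (γ := a 3) fun v => ?_
    rw [hinv v (-v 2 / p 2)]
    simp [qf_eq, dotProduct, Fin.sum_univ_three]
    field_simp
    ring

/-- If a split conic does not contain a line, it has at most two points. -/
theorem ncard_zeros_le_two_of_splits {L : Type*} [Field L] (f : K →+* L) {a : Fin 6 → K}
    (h : Splits f a) (hline : ∀ ℓ, ¬ pts ℓ ⊆ zeros a) : (zeros a).ncard ≤ 2 := by
  obtain ⟨l, m, hlm⟩ := h
  -- If a linear factor over `L` had two zeros with coordinates in `K`, it would vanish on the line
  -- joining them, and the conic would contain that line. So each factor has at most one such zero.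
  have key : ∀ k : Fin 3 → L, (∀ v : Fin 3 → K, (f ∘ v) ⬝ᵥ k = 0 → qf a v = 0) →
      {P : Plane K | (f ∘ P.rep) ⬝ᵥ k = 0}.Subsingleton := by
    intro k hk P hP Q hQ
    by_contra hne
    obtain ⟨ℓ, hPℓ, hQℓ⟩ := exists_line_through hne
    refine hline ℓ fun R hR => hk _ ?_
    obtain ⟨x, y, hxy⟩ := exists_rep_eq_combination hne hPℓ hQℓ hR
    have : f ∘ R.rep = f x • (f ∘ P.rep) + f y • (f ∘ Q.rep) := by
      rw [hxy]
      ext i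
      simp
    rw [Set.mem_ofPred_eq] at hP hQ
    rw [this, add_dotProduct, smul_dotProduct, smul_dotProduct, hP, hQ, smul_zero, smul_zero,
      add_zero]
  have h1 := key l fun v hv => f.injective (by rw [hlm, hv, zero_mul, map_zero])
  have h2 := key m fun v hv => f.injective (by rw [hlm, hv, mul_zero, map_zero])
  have heq : zeros a = {P | (f ∘ P.rep) ⬝ᵥ l = 0} ∪ {P | (f ∘ P.rep) ⬝ᵥ m = 0} := by
    ext P
    rw [mem_zeros, ← map_eq_zero f, hlm, mul_eq_zero]
    rfl
  rw [heq]
  have := h1.finite.to_subtype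
  have := h2.finite.to_subtype
  have g1 := Set.ncard_le_one_iff_subsingleton.2 h1
  have g2 := Set.ncard_le_one_iff_subsingleton.2 h2
  exact (Set.ncard_union_le _ _).trans (by omega)

end ConicsOverAField

/-! ### Numbers of points of conics over a finite field -/

section ConicsOverAFiniteField

variable {K : Type*} [Field K] [Fintype K]

/-- The affine cone over a conic. -/
theorem ncard_affine_zeros (a : Fin 6 → K) :
    {v : Fin 3 → K | qf a v = 0}.ncard = (zeros a).ncard * (Fintype.card K - 1) + 1 := by
  classical
  have h0 : qf a 0 = 0 := by simp [qf_eq]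
  have hins : {v : Fin 3 → K | qf a v = 0} = insert 0 {v | v ≠ 0 ∧ qf a v = 0} := by
    ext v
    by_cases hv : v = 0 <;> simp [hv, h0]
  rw [hins, Set.ncard_insert_of_notMem (by simp)]
  congr 1
  let g : zeros a × Kˣ → {v : Fin 3 → K | v ≠ 0 ∧ qf a v = 0} := fun x =>
    ⟨(x.2 : K) • x.1.1.rep, smul_ne_zero x.2.ne_zero x.1.1.rep_nonzero, by
      rw [qf_smul, x.1.2, mul_zero]⟩
  have hg : Function.Bijective g := by
    constructor
    · rintro ⟨⟨P, hP⟩, c⟩ ⟨⟨Q, hQ⟩, d⟩ h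
      have h' : (c : K) • P.rep = (d : K) • Q.rep := congrArg Subtype.val h
      have hPQ : P = Q := by
        rw [← P.mk_rep, mk_eq_iff_exists]
        refine ⟨(c : K)⁻¹ * d, ?_⟩
        rw [mul_smul, ← h', smul_smul, inv_mul_cancel₀ c.ne_zero, one_smul]
      subst hPQ
      have hcd := smul_left_injective K P.rep_nonzero h'
      rw [Units.ext hcd]
    · rintro ⟨v, hv, hav⟩
      obtain ⟨c, hc⟩ := (mk_eq_iff_exists hv _).1 rfl
      have hc0 : c ≠ 0 := by
        rintro rfl
        exact hv (by rw [← hc, zero_smul])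
      refine ⟨⟨⟨Projectivization.mk K v hv, ?_⟩, Units.mk0 c hc0⟩, Subtype.ext hc⟩
      rw [mem_zeros]
      rw [← hc, qf_smul] at hav
      exact (mul_eq_zero.1 hav).resolve_left (pow_ne_zero 2 hc0)
  rw [← Nat.card_coe_set_eq, ← Nat.card_congr (Equiv.ofBijective g hg), Nat.card_prod,
    Nat.card_coe_set_eq, Nat.card_eq_fintype_card, Fintype.card_units]

/-- By the Chevalley-Warning theorem, the number of points of a conic is neither `0` nor `2`. -/
theorem ncard_zeros_ne (a : Fin 6 → K) : (zeros a).ncard ≠ 0 ∧ (zeros a).ncard ≠ 2 := by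
  classical
  obtain ⟨p, hp⟩ := CharP.exists K
  have hprime : p.Prime :=
    (CharP.char_is_prime_or_zero K p).resolve_right (CharP.char_ne_zero_of_finite K p)
  have h := char_dvd_card_solutions p (K := K) (f := formPoly a)
    ((isHomogeneous_formPoly a).totalDegree_le.trans_lt (by simp))
  have hcard : Fintype.card {x : Fin 3 → K // MvPolynomial.eval x (formPoly a) = 0} =
      {v : Fin 3 → K | qf a v = 0}.ncard := by
    rw [← Nat.card_coe_set_eq, ← Nat.card_eq_fintype_card]
    simp_rw [eval_formPoly]
    rfl
  -- With `N` projective zeros there are `N * (q - 1) + 1` affine ones, and the characteristic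
  -- divides this number since 2 is less than the number of variables. Modulo `p` it is `1` for `N =
  -- 0` and `-1` for `N = 2`.
  rw [hcard, ncard_affine_zeros] at h
  have hq : p ∣ Fintype.card K := by
    rw [← CharP.cast_eq_zero_iff K p, Nat.cast_card_eq_zero]
  have h1 := Fintype.one_lt_card (α := K)
  constructor
  · intro h0
    rw [h0, zero_mul, zero_add] at h
    exact hprime.one_lt.ne' (Nat.dvd_one.1 h)
  · intro h2
    rw [h2] at h
    have h3 : p ∣ 1 := by
      have := (Nat.dvd_add_right h).1 (show p ∣ 2 * (Fintype.card K - 1) + 1 + 1 by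
        rw [show 2 * (Fintype.card K - 1) + 1 + 1 = 2 * Fintype.card K by omega]
        exact hq.mul_left 2)
      exact this
    exact hprime.one_lt.ne' (Nat.dvd_one.1 h3)

/-- A split conic without a rational line has at most two points, and 0 and 2 are excluded by the
congruence. -/
theorem ncard_zeros_eq_one {a : Fin 6 → K} (h : ¬ IsIrred a) (hline : ∀ ℓ, ¬ pts ℓ ⊆ zeros a) :
    (zeros a).ncard = 1 := by
  have h1 := ncard_zeros_le_two_of_splits _ (not_not.1 h) hline
  have h2 := ncard_zeros_ne a
  omega

theorem ncard_lineSpace (ℓ : Plane K) :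
    {v : Fin 3 → K | v ⬝ᵥ ℓ.rep = 0}.ncard = Fintype.card K ^ 2 := by
  rw [show {v : Fin 3 → K | v ⬝ᵥ ℓ.rep = 0} = (lineSpace ℓ : Set (Fin 3 → K)) from
    Set.ext fun v => mem_lineSpace.symm, ← Nat.card_coe_set_eq, ← finrank_lineSpace ℓ,
    ← Nat.card_eq_fintype_card (α := K)]
  exact Module.natCard_eq_pow_finrank

/-- An irreducible conic with a point `P` meets the tangent line at `P` only in `P`, and each
other affine line in the direction `P` exactly once. -/
theorem ncard_affine_zeros_of_isIrred {a : Fin 6 → K} (h : IsIrred a) :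
    {v : Fin 3 → K | qf a v = 0}.ncard = Fintype.card K ^ 2 := by
  classical
  have hq := Fintype.one_lt_card (α := K)
  obtain ⟨P, hP⟩ := Set.nonempty_of_ncard_ne_zero (ncard_zeros_ne a).1
  have ht : tangent a P.rep ≠ 0 := fun ht => h (splits_of_tangent_eq_zero _ P.rep_nonzero hP ht)
  obtain ⟨c, hc⟩ := (mk_eq_iff_exists ht _).1 rfl
  set ℓ := Projectivization.mk K _ ht with hℓ
  have hc0 : c ≠ 0 := by
    rintro rfl
    exact ht (by rw [← hc, zero_smul])
  have hdot : ∀ v : Fin 3 → K, v ⬝ᵥ tangent a P.rep = 0 ↔ v ⬝ᵥ ℓ.rep = 0 := fun v => by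
    rw [← hc, dotProduct_smul, smul_eq_mul, mul_eq_zero, or_iff_right hc0]
  rw [mem_zeros] at hP
  have hPℓ : P ∈ pts ℓ := by
    rw [mem_pts, ← hdot, ← polar_eq, polar_self, hP, mul_zero]
  have hmeet : ∀ R ∈ pts ℓ, R ∈ zeros a → R = P := by
    intro R hR haR
    by_contra hne
    refine not_isIrred_of_pts_subset (ℓ := ℓ) (fun S hS => ?_) h
    obtain ⟨x, y, hxy⟩ := exists_rep_eq_combination (Ne.symm hne) hPℓ hR hS
    rw [mem_zeros] at haR ⊢
    rw [hxy, qf_combination, polar_eq, hP, haR, (hdot _).2 (mem_pts.1 hR)]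
    ring
  have hcone : {v : Fin 3 → K | qf a v = 0 ∧ v ⬝ᵥ tangent a P.rep = 0} =
      Set.range fun t : K => t • P.rep := by
    ext v
    constructor
    · rintro ⟨h1, h2⟩
      by_cases hv : v = 0
      · exact ⟨0, by rw [hv]; exact zero_smul _ _⟩
      · rw [hdot, ← mk_mem_pts hv] at h2
        refine (mk_eq_iff_exists hv P).1 (hmeet _ h2 ?_)
        obtain ⟨d, hd⟩ := (mk_eq_iff_exists hv _).1 rfl
        rw [mem_zeros]
        rw [← hd, qf_smul] at h1
        refine (mul_eq_zero.1 h1).resolve_left (pow_ne_zero 2 ?_)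
        rintro rfl
        exact hv (by rw [← hd, zero_smul])
    · rintro ⟨t, rfl⟩
      refine ⟨by rw [qf_smul, hP, mul_zero], ?_⟩
      rw [hdot, smul_dotProduct, mem_pts.1 hPℓ, smul_zero]
  have hcard1 : {v : Fin 3 → K | qf a v = 0 ∧ v ⬝ᵥ tangent a P.rep = 0}.ncard =
      Fintype.card K := by
    rw [hcone, ← Set.image_univ,
      Set.ncard_image_of_injective _ (smul_left_injective K P.rep_nonzero), Set.ncard_univ,
      Nat.card_eq_fintype_card]
  have hcard2 : {v : Fin 3 → K | v ⬝ᵥ tangent a P.rep ≠ 0}.ncard + Fintype.card K ^ 2 =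
      Fintype.card K ^ 3 := by
    simp_rw [Ne, hdot]
    rw [← ncard_lineSpace ℓ, add_comm, ← Set.compl_ofPred, Set.ncard_add_ncard_compl,
      Nat.card_eq_fintype_card]
    simp
  have hcard3 : {v : Fin 3 → K | v ⬝ᵥ tangent a P.rep ≠ 0}.ncard =
      {v : Fin 3 → K | qf a v = 0 ∧ v ⬝ᵥ tangent a P.rep ≠ 0}.ncard * Fintype.card K := by
    -- Off the tangent plane the form is affine in `t` along `v + t • P.rep`, with nonzero slope `v
    -- ⬝ᵥ tangent a P.rep`. Each such affine line thus contains exactly one zero, and zeros together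
    -- with translations parametrize all vectors off the tangent plane.
    let g : {v : Fin 3 → K | qf a v = 0 ∧ v ⬝ᵥ tangent a P.rep ≠ 0} × K →
        {v : Fin 3 → K | v ⬝ᵥ tangent a P.rep ≠ 0} := fun x => ⟨x.1.1 + x.2 • P.rep, by
      have := x.1.2.2
      rw [Set.mem_ofPred_eq, add_dotProduct, smul_dotProduct, (hdot P.rep).2 (mem_pts.1 hPℓ),
        smul_zero, add_zero]
      exact this⟩
    have hPt : P.rep ⬝ᵥ tangent a P.rep = 0 := (hdot P.rep).2 (mem_pts.1 hPℓ)
    have hg : Function.Bijective g := by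
      constructor
      · rintro ⟨⟨v, hv, hv'⟩, s⟩ ⟨⟨w, hw, hw'⟩, t⟩ hst
        have h1 : v + s • P.rep = w + t • P.rep := congrArg Subtype.val hst
        have h2 : v = w + (t - s) • P.rep := by
          rw [sub_smul, ← add_sub_assoc, ← h1, add_sub_cancel_right]
        have h3 := hv
        rw [h2, qf_add_smul, hw, hP, mul_zero, add_zero, zero_add] at h3
        have h4 : t = s := sub_eq_zero.1 ((mul_eq_zero.1 h3).resolve_right hw')
        subst h4
        rw [sub_self, zero_smul, add_zero] at h2
        subst h2
        rfl
      · rintro ⟨v, hv⟩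
        rw [Set.mem_ofPred_eq] at hv
        refine ⟨⟨⟨v + (-(qf a v) / (v ⬝ᵥ tangent a P.rep)) • P.rep, ?_, ?_⟩,
          qf a v / (v ⬝ᵥ tangent a P.rep)⟩, Subtype.ext ?_⟩
        · rw [qf_add_smul, hP, div_mul_cancel₀ _ hv]
          ring
        · rwa [add_dotProduct, smul_dotProduct, hPt, smul_zero, add_zero]
        · change v + (-(qf a v) / (v ⬝ᵥ tangent a P.rep)) • P.rep +
            (qf a v / (v ⬝ᵥ tangent a P.rep)) • P.rep = v
          rw [neg_div, neg_smul, neg_add_cancel_right]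
    rw [← Nat.card_coe_set_eq, ← Nat.card_congr (Equiv.ofBijective g hg), Nat.card_prod,
      Nat.card_coe_set_eq, Nat.card_eq_fintype_card]
  have hsplit : {v : Fin 3 → K | qf a v = 0}.ncard =
      {v : Fin 3 → K | qf a v = 0 ∧ v ⬝ᵥ tangent a P.rep = 0}.ncard +
        {v : Fin 3 → K | qf a v = 0 ∧ v ⬝ᵥ tangent a P.rep ≠ 0}.ncard := by
    rw [← Set.ncard_union_eq]
    · congr 1
      ext v
      by_cases hv : v ⬝ᵥ tangent a P.rep = 0 <;> simp [hv]
    · rw [Set.disjoint_left]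
      rintro v ⟨-, h1⟩ ⟨-, h2⟩
      exact h2 h1
  -- There are `q` zeros on the tangent plane and `(q ^ 3 - q ^ 2) / q` off it, together `q ^ 2`.
  rw [hsplit, hcard1]
  rw [hcard3] at hcard2
  apply Nat.eq_of_mul_eq_mul_right (show 0 < Fintype.card K by omega)
  linarith

theorem ncard_zeros_of_isIrred {a : Fin 6 → K} (h : IsIrred a) :
    (zeros a).ncard = Fintype.card K + 1 := by
  have h1 := ncard_affine_zeros a
  rw [ncard_affine_zeros_of_isIrred h] at h1
  obtain ⟨k, hk⟩ : ∃ k, Fintype.card K = k + 2 :=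
    ⟨Fintype.card K - 2, by have := Fintype.one_lt_card (α := K); omega⟩
  rw [hk] at h1 ⊢
  apply Nat.eq_of_mul_eq_mul_right (show 0 < k + 1 by omega)
  rw [show k + 2 - 1 = k + 1 by omega] at h1
  linarith

end ConicsOverAFiniteField
-- Closed sets of dimension 1
section FlatsOfConics

variable {K : Type*} [Field K]

theorem ncard_pair_le {α : Type*} (a b : α) : ({a, b} : Set α).ncard ≤ 2 :=
  (Set.ncard_insert_le a {b}).trans (by rw [Set.ncard_singleton])

theorem mem_linePairs_iff {S : Set (Plane K)} :
    S ∈ linePairs K ↔ ∃ ℓ m, ℓ ≠ m ∧ S = pts ℓ ∪ pts m := by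
  constructor
  · rintro ⟨L, hL, L', hL', hne, rfl⟩
    obtain ⟨ℓ, rfl⟩ := mem_lines_iff.1 hL
    obtain ⟨m, rfl⟩ := mem_lines_iff.1 hL'
    exact ⟨ℓ, m, fun h => hne (by rw [h]), rfl⟩
  · rintro ⟨ℓ, m, hne, rfl⟩
    exact ⟨_, mem_lines_iff.2 ⟨ℓ, rfl⟩, _, mem_lines_iff.2 ⟨m, rfl⟩, pts_injective.ne hne, rfl⟩

theorem exists_zeros_of_mem_flats {S : Set (Plane K)} (hS : S ∈ flats K 1) :
    ∃ a, a ≠ 0 ∧ S = zeros a := by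
  obtain ⟨a, ha0, ha⟩ := finrank_eq_one_iff'.1 (show Module.finrank K (vanishing S) = 1 from hS.2)
  refine ⟨a, fun h => ha0 (Subtype.ext h), Set.Subset.antisymm a.2 (Set.Subset.trans ?_ hS.1.subset)⟩
  intro P hP b hb
  obtain ⟨c, hc⟩ := ha ⟨b, hb⟩
  have hc' : c • (a : Fin 6 → K) = b := congrArg Subtype.val hc
  rw [mem_zeros, ← hc', qf_smul_left, hP, mul_zero]

variable [Fintype K]

/-- The four kinds of conics. -/
theorem zeros_cases {a : Fin 6 → K} (ha : a ≠ 0) : zeros a ∈ irreducibleConics K ∨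
    zeros a ∈ linePairs K ∨ zeros a ∈ lines K ∨ (zeros a).ncard = 1 := by
  by_cases h : IsIrred a
  · exact Or.inl (mem_irreducibleConics_iff.2 ⟨a, h, rfl⟩)
  by_cases hline : ∀ ℓ, ¬ pts ℓ ⊆ zeros a
  · exact Or.inr (Or.inr (Or.inr (ncard_zeros_eq_one h hline)))
  push Not at hline
  obtain ⟨ℓ, hℓ⟩ := hline
  obtain ⟨m, c, hc, rfl⟩ := exists_eq_smul_lineMul ha hℓ
  rw [zeros_smul hc, zeros_lineMul]
  by_cases hm : ℓ = m
  · subst hm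
    rw [Set.union_self]
    exact Or.inr (Or.inr (Or.inl (mem_lines_iff.2 ⟨ℓ, rfl⟩)))
  · exact Or.inr (Or.inl (mem_linePairs_iff.2 ⟨ℓ, m, hm, rfl⟩))

/-- Two points of the second line other than the intersection point lower the dimension of the first
line from 3 to 1. With the intersection point they are three collinear points, so the closure
contains the second line. -/
theorem linePairs_subset_flats : linePairs K ⊆ flats K 1 := by
  intro S hS
  obtain ⟨ℓ, m, hne, rfl⟩ := mem_linePairs_iff.1 hS
  have hq := Fintype.one_lt_card (α := K)
  obtain ⟨O, hO, hO'⟩ := exists_meet hne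
  obtain ⟨P, hP, hPO⟩ := exists_mem_pts_notMem m (S := {O}) (by simp; omega)
  obtain ⟨Q, hQ, hQO⟩ := exists_mem_pts_notMem m (S := {O, P})
    ((ncard_pair_le O P).trans (by omega))
  simp only [Set.mem_insert_iff, Set.mem_singleton_iff, not_or] at hPO hQO
  have hout : ∀ X ∈ pts m, X ≠ O → X ∉ pts ℓ := by
    intro X hX hXO hXℓ
    rcases eq_or_eq_of_mem_pts hXℓ hO hX hO' with h | h
    · exact hXO h
    · exact hne h
  have h1 := insert_pts_mem_flats (hout P hP hPO)
  have h2 : Q ∉ insert P (pts ℓ) := by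
    rintro (h | h)
    · exact hQO.2 h
    · exact hout Q hQ hQO.1 h
  have h3 := hull_insert_mem_flats h1 h2
  convert! h3 using 1
  apply Set.Subset.antisymm
  · refine Set.union_subset (fun X hX => subset_hull _ (by simp [hX])) ?_
    exact pts_subset_hull (Ne.symm hPO) (Ne.symm hQO.1) (Ne.symm hQO.2) hO' hP hQ
      (by simp [hO]) (by simp) (by simp)
  · rw [hull_subset_iff (hull_pts_union_pts ℓ m)]
    rintro X (rfl | rfl | h)
    · exact Or.inr hQ
    · exact Or.inr hP
    · exact Or.inl h

theorem IsIrred.nonCollinear {a : Fin 6 → K} (h : IsIrred a) {A B C : Plane K} (hAB : A ≠ B)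
    (hAC : A ≠ C) (hBC : B ≠ C) (hA : A ∈ zeros a) (hB : B ∈ zeros a) (hC : C ∈ zeros a) :
    NonCollinear A B C := fun _ h1 h2 h3 =>
  not_isIrred_of_pts_subset (pts_subset_zeros hAB hAC hBC h1 h2 h3 hA hB hC) h

/-- The bound on `q` provides five points on the conic, no three collinear. Four form a
quadrilateral, closed of dimension 2, so the fifth leaves a single form up to scalars. -/
theorem irreducibleConics_subset_flats (hq : 4 ≤ Fintype.card K) :
    irreducibleConics K ⊆ flats K 1 := by
  intro S hS
  obtain ⟨a, ha, rfl⟩ := mem_irreducibleConics_iff.1 hS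
  have hcard := ncard_zeros_of_isIrred ha
  have pick : ∀ T : Set (Plane K), T.ncard ≤ 4 → ∃ P ∈ zeros a, P ∉ T := fun T hT =>
    Set.exists_mem_notMem_of_ncard_lt_ncard (by omega) (Set.toFinite _)
  obtain ⟨A, hA, -⟩ := pick ∅ (by simp)
  obtain ⟨B, hB, hBA⟩ := pick {A} (by simp)
  have hBA' : B ≠ A := hBA
  obtain ⟨C, hC, hCAB⟩ := pick {A, B} (by rw [Set.ncard_pair hBA'.symm]; norm_num)
  simp only [Set.mem_insert_iff, Set.mem_singleton_iff, not_or] at hCAB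
  have h3 : ({A, B, C} : Set (Plane K)).ncard = 3 :=
    Set.ncard_eq_three.2 ⟨A, B, C, hBA'.symm, Ne.symm hCAB.1, Ne.symm hCAB.2, rfl⟩
  obtain ⟨D, hD, hDABC⟩ := pick {A, B, C} (by rw [h3]; norm_num)
  have h4 : ({D, A, B, C} : Set (Plane K)).ncard = 4 := by
    rw [Set.ncard_insert_of_notMem hDABC, h3]
  obtain ⟨E, hE, hE'⟩ := pick {D, A, B, C} h4.le
  simp only [Set.mem_insert_iff, Set.mem_singleton_iff, not_or] at hDABC
  obtain ⟨hDA, hDB, hDC⟩ := hDABC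
  obtain ⟨hCA, hCB⟩ := hCAB
  have hquad : {D, A, B, C} ∈ flats K 2 := by
    apply quadrilaterals_subset_flats
    rw [insert_mem_quadrilaterals_iff hBA'.symm (Ne.symm hCA) (Ne.symm hCB) hDA hDB hDC]
    exact ⟨ha.nonCollinear hBA'.symm (Ne.symm hCA) (Ne.symm hCB) hA hB hC,
      ha.nonCollinear hBA'.symm (Ne.symm hDA) (Ne.symm hDB) hA hB hD,
      ha.nonCollinear (Ne.symm hCA) (Ne.symm hDA) (Ne.symm hDC) hA hC hD,
      ha.nonCollinear (Ne.symm hCB) (Ne.symm hDB) (Ne.symm hDC) hB hC hD⟩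
  have hfive := hull_insert_mem_flats hquad hE'
  have hsub : insert E {D, A, B, C} ⊆ zeros a := by
    rintro X (rfl | rfl | rfl | rfl | rfl) <;> assumption
  -- The five points have dimension 1, and the conic has dimension at least 1 because `a` itself is
  -- nonzero; so their hull is the whole conic.
  rw [eq_hull_of_subset (hull_zeros a) hsub] at hfive
  · exact hfive
  · have h1 := hfive.2
    rw [dimVan_hull] at h1
    rw [h1, dimVan, Nat.one_le_iff_ne_zero, Ne, Submodule.finrank_eq_zero]
    exact fun hbot => ha.ne_zero ((Submodule.eq_bot_iff _).1 hbot a (mem_vanishing.2 subset_rfl))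

theorem flats_one (hq : 4 ≤ Fintype.card K) :
    flats K 1 = linePairs K ∪ irreducibleConics K := by
  apply Set.Subset.antisymm
  · intro S hS
    obtain ⟨a, ha, rfl⟩ := exists_zeros_of_mem_flats hS
    rcases zeros_cases ha with h | h | h | h
    · exact Or.inr h
    · exact Or.inl h
    · obtain ⟨ℓ, hℓ⟩ := mem_lines_iff.1 h
      have h1 := hS.2
      rw [hℓ, (pts_mem_flats ℓ).2] at h1
      norm_num at h1
    · have h5 : zeros a ∈ flats K 5 := by
        rw [flats_five]
        exact h
      have h1 := hS.2
      rw [h5.2] at h1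
      norm_num at h1
  · exact Set.union_subset linePairs_subset_flats (irreducibleConics_subset_flats hq)

end FlatsOfConics

/-! ### Counting lines, point sets and line pairs -/

section Counts

variable {K : Type*} [Field K] [Fintype K]

/-- Double counting of the one-point extensions of the members of a family of `k`-sets. -/
theorem ncard_mul_of_insert {α : Type*} [Finite α] {A B : Set (Set α)} {k c : ℕ}
    (hB : ∀ S ∈ B, S.ncard = k) (hrem : ∀ S ∈ B, ∀ x ∈ S, S \ {x} ∈ A)
    (hadd : ∀ T ∈ A, {x | x ∉ T ∧ insert x T ∈ B}.ncard = c) : k * B.ncard = c * A.ncard := by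
  classical
  have := Fintype.ofFinite α
  let g : (Σ S : B, {x // x ∈ S.1}) ≃ (Σ T : A, {x // x ∉ T.1 ∧ insert x T.1 ∈ B}) :=
    { toFun := fun p => ⟨⟨p.1.1 \ {p.2.1}, hrem _ p.1.2 _ p.2.2⟩, p.2.1, by simp, by
        rw [Set.insert_sdiff_singleton, Set.insert_eq_of_mem p.2.2]
        exact p.1.2⟩
      invFun := fun p => ⟨⟨insert p.2.1 p.1.1, p.2.2.2⟩, p.2.1, Set.mem_insert _ _⟩
      left_inv := fun p => by
        refine Sigma.subtype_ext (Subtype.ext ?_) rfl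
        simp only
        rw [Set.insert_sdiff_singleton, Set.insert_eq_of_mem p.2.2]
      right_inv := fun p => by
        refine Sigma.subtype_ext (Subtype.ext ?_) rfl
        simp only
        rw [Set.insert_sdiff_self_of_notMem p.2.2.1] }
  have h := Nat.card_congr g
  rw [Nat.card_sigma, Nat.card_sigma] at h
  have h1 : ∀ S : B, Nat.card {x // x ∈ S.1} = k := fun S =>
    (Nat.card_coe_set_eq S.1).trans (hB S.1 S.2)
  have h2 : ∀ T : A, Nat.card {x // x ∉ T.1 ∧ insert x T.1 ∈ B} = c := fun T =>
    (Nat.card_coe_set_eq {x | x ∉ T.1 ∧ insert x T.1 ∈ B}).trans (hadd T.1 T.2)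
  simp_rw [h1, h2, Finset.sum_const, smul_eq_mul, Finset.card_univ, ← Nat.card_eq_fintype_card,
    Nat.card_coe_set_eq] at h
  rw [mul_comm, h, mul_comm]

theorem ncard_pointSets_one : (pointSets K 1).ncard = Fintype.card K ^ 2 + Fintype.card K + 1 := by
  have h : pointSets K 1 = (fun P : Plane K => {P}) '' Set.univ := by
    ext S
    rw [Set.image_univ, Set.mem_range]
    exact Set.ncard_eq_one.trans ⟨fun ⟨P, hP⟩ => ⟨P, hP.symm⟩, fun ⟨P, hP⟩ => ⟨P, hP.symm⟩⟩
  rw [h, Set.ncard_image_of_injective _ Set.singleton_injective, Set.ncard_univ, natCard_plane]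

theorem ncard_lines : (lines K).ncard = Fintype.card K ^ 2 + Fintype.card K + 1 := by
  have h : lines K = pts '' Set.univ := by
    ext S
    rw [Set.image_univ, Set.mem_range, mem_lines_iff]
    exact ⟨fun ⟨P, hP⟩ => ⟨P, hP.symm⟩, fun ⟨P, hP⟩ => ⟨P, hP.symm⟩⟩
  rw [h, Set.ncard_image_of_injective _ pts_injective, Set.ncard_univ, natCard_plane]

theorem ncard_compl_eq (S : Set (Plane K)) :
    Sᶜ.ncard + S.ncard = Fintype.card K ^ 2 + Fintype.card K + 1 := by
  rw [add_comm, Set.ncard_add_ncard_compl, natCard_plane]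

theorem two_mul_ncard_pointSets_two : 2 * (pointSets K 2).ncard =
    (Fintype.card K ^ 2 + Fintype.card K) * (Fintype.card K ^ 2 + Fintype.card K + 1) := by
  rw [← ncard_pointSets_one]
  refine ncard_mul_of_insert (fun S hS => hS) (fun S hS x hx => ?_) (fun T hT => ?_)
  · have h := Set.ncard_sdiff_singleton_add_one hx
    change (S \ {x}).ncard = 1
    have hS' : S.ncard = 2 := hS
    omega
  · have h : {x | x ∉ T ∧ insert x T ∈ pointSets K 2} = Tᶜ := by
      ext x
      refine and_iff_left_of_imp fun hx => ?_
      change (insert x T).ncard = 2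
      rw [Set.ncard_insert_of_notMem hx, show T.ncard = 1 from hT]
    have h1 := ncard_compl_eq T
    rw [show T.ncard = 1 from hT] at h1
    rw [h]
    omega

/-- A pair extends to a triangle by each of the `q ^ 2` points off its line. -/
theorem three_mul_ncard_triangles :
    3 * (triangles K).ncard = Fintype.card K ^ 2 * (pointSets K 2).ncard := by
  refine ncard_mul_of_insert (fun S hS => hS.1) (fun S hS x hx => ?_) (fun T hT => ?_)
  · have h := Set.ncard_sdiff_singleton_add_one hx
    change (S \ {x}).ncard = 2
    have hS' : S.ncard = 3 := hS.1
    omega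
  · obtain ⟨A, B, hAB, rfl⟩ := Set.ncard_eq_two.1 hT
    obtain ⟨ℓ, hA, hB⟩ := exists_line_through hAB
    have h : {x | x ∉ ({A, B} : Set (Plane K)) ∧ insert x {A, B} ∈ triangles K} = (pts ℓ)ᶜ := by
      ext x
      constructor
      · rintro ⟨-, -, h⟩ hx
        refine h (isCollinear_iff.2 ⟨ℓ, ?_⟩)
        rintro Y (rfl | rfl | rfl) <;> assumption
      · intro hx
        have hxA : x ≠ A := by rintro rfl; exact hx hA
        have hxB : x ≠ B := by rintro rfl; exact hx hB
        refine ⟨by simp [hxA, hxB], mem_triangles_iff.2 ⟨x, A, B, hxA, hxB, hAB, ?_, rfl⟩⟩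
        intro m hxm hAm hBm
        rcases eq_or_eq_of_mem_pts hA hB hAm hBm with h | rfl
        · exact hAB h
        · exact hx hxm
    have h1 := ncard_compl_eq (pts ℓ)
    rw [ncard_pts] at h1
    rw [h]
    omega

/-- The three sides of a triangle have `3 q` points. -/
theorem ncard_sides {A B C c b a : Plane K} (h : NonCollinear A B C)
    (hAC : A ≠ C) (hcA : A ∈ pts c) (hcB : B ∈ pts c) (hbA : A ∈ pts b)
    (hbC : C ∈ pts b) (haB : B ∈ pts a) (haC : C ∈ pts a) (hAB : A ≠ B) (hBC : B ≠ C) :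
    (pts c ∪ pts b ∪ pts a).ncard = 3 * Fintype.card K := by
  have h1 : pts c ∩ pts b = {A} := by
    ext X
    refine ⟨fun hX => h.eq_of_mem hcA hcB hbA hbC hX.1 hX.2, ?_⟩
    rintro rfl
    exact ⟨hcA, hbA⟩
  have h2 : (pts c ∪ pts b) ∩ pts a = {B, C} := by
    ext X
    constructor
    · rintro ⟨hX | hX, hXa⟩
      · exact Or.inl (h.swap.eq_of_mem hcB hcA haB haC hX hXa)
      · exact Or.inr (h.rotate.rotate.eq_of_mem hbC hbA haC haB hX hXa)
    · rintro (rfl | rfl)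
      · exact ⟨Or.inl hcB, haB⟩
      · exact ⟨Or.inr hbC, haC⟩
  have h3 := Set.ncard_union_add_ncard_inter (pts c) (pts b)
  have h4 := Set.ncard_union_add_ncard_inter (pts c ∪ pts b) (pts a)
  rw [h1, Set.ncard_singleton, ncard_pts, ncard_pts] at h3
  rw [h2, Set.ncard_pair hBC, ncard_pts] at h4
  omega

/-- A triangle extends by each point off its three sides, and `q ^ 2 + q + 1 - 3 * q = (q - 1) ^ 2`.
-/
theorem four_mul_ncard_quadrilaterals :
    4 * (quadrilaterals K).ncard = (Fintype.card K - 1) ^ 2 * (triangles K).ncard := by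
  refine ncard_mul_of_insert (fun S hS => hS.1) (fun S hS x hx => ?_) (fun T hT => ?_)
  · have h := Set.ncard_sdiff_singleton_add_one hx
    rw [hS.1] at h
    have h3 : (S \ {x}).ncard = 3 := by omega
    exact ⟨h3, hS.2 _ Set.sdiff_subset h3⟩
  · obtain ⟨A, B, C, hAB, hAC, hBC, hcol, rfl⟩ := mem_triangles_iff.1 hT
    obtain ⟨c, hcA, hcB⟩ := exists_line_through hAB
    obtain ⟨b, hbA, hbC⟩ := exists_line_through hAC
    obtain ⟨a, haB, haC⟩ := exists_line_through hBC
    have hnc : ∀ {X Y Z ℓ : Plane K}, X ≠ Y → X ∈ pts ℓ → Y ∈ pts ℓ → Z ∉ pts ℓ →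
        NonCollinear X Y Z := by
      intro X Y Z ℓ hXY hX hY hZ m hXm hYm hZm
      rcases eq_or_eq_of_mem_pts hX hY hXm hYm with h | rfl
      · exact hXY h
      · exact hZ hZm
    have h : {x | x ∉ ({A, B, C} : Set (Plane K)) ∧ insert x {A, B, C} ∈ quadrilaterals K} =
        (pts c ∪ pts b ∪ pts a)ᶜ := by
      ext x
      constructor
      · rintro ⟨hx, h⟩
        simp only [Set.mem_insert_iff, Set.mem_singleton_iff, not_or] at hx
        obtain ⟨-, h2, h3, h4⟩ :=
          (insert_mem_quadrilaterals_iff hAB hAC hBC hx.1 hx.2.1 hx.2.2).1 h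
        rintro ((h | h) | h)
        · exact h2 c hcA hcB h
        · exact h3 b hbA hbC h
        · exact h4 a haB haC h
      · intro hx
        simp only [Set.mem_compl_iff, Set.mem_union, not_or] at hx
        obtain ⟨⟨hxc, hxb⟩, hxa⟩ := hx
        have hxA : x ≠ A := by rintro rfl; exact hxc hcA
        have hxB : x ≠ B := by rintro rfl; exact hxc hcB
        have hxC : x ≠ C := by rintro rfl; exact hxb hbC
        exact ⟨by simp [hxA, hxB, hxC],
          (insert_mem_quadrilaterals_iff hAB hAC hBC hxA hxB hxC).2
            ⟨hcol, hnc hAB hcA hcB hxc, hnc hAC hbA hbC hxb, hnc hBC haB haC hxa⟩⟩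
    have h1 := ncard_compl_eq (pts c ∪ pts b ∪ pts a)
    rw [ncard_sides hcol hAC hcA hcB hbA hbC haB haC hAB hBC] at h1
    rw [h]
    obtain ⟨k, hk⟩ : ∃ k, Fintype.card K = k + 1 :=
      ⟨Fintype.card K - 1, by have := Fintype.one_lt_card (α := K); omega⟩
    rw [hk] at h1 ⊢
    rw [Nat.add_sub_cancel]
    linarith

theorem ncard_linesWithPoint : (linesWithPoint K).ncard =
    (Fintype.card K ^ 2 + Fintype.card K + 1) * Fintype.card K ^ 2 := by
  classical
  have := Fintype.ofFinite (Plane K)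
  have hq := Fintype.one_lt_card (α := K)
  let g : (Σ ℓ : Plane K, {P // P ∉ pts ℓ}) → linesWithPoint K := fun x =>
    ⟨insert x.2.1 (pts x.1), mem_linesWithPoint_iff.2 ⟨x.1, x.2.1, x.2.2, rfl⟩⟩
  have hg : Function.Bijective g := by
    constructor
    · rintro ⟨ℓ, P, hP⟩ ⟨m, Q, hQ⟩ h
      have h' : insert P (pts ℓ) = insert Q (pts m) := congrArg Subtype.val h
      -- The line has at least three points, hence two that differ from the extra point `Q`; these
      -- determine it.
      have hℓm : ℓ = m := by
        obtain ⟨A, hA, hAQ⟩ := exists_mem_pts_notMem ℓ (S := {Q}) (by simp; omega)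
        obtain ⟨B, hB, hBQ⟩ := exists_mem_pts_notMem ℓ (S := {Q, A})
          ((ncard_pair_le Q A).trans (by omega))
        simp only [Set.mem_insert_iff, Set.mem_singleton_iff, not_or] at hAQ hBQ
        have hA' : A ∈ pts m := (h'.subset (Or.inr hA)).resolve_left hAQ
        have hB' : B ∈ pts m := (h'.subset (Or.inr hB)).resolve_left hBQ.1
        exact (eq_or_eq_of_mem_pts hB hA hB' hA').resolve_left hBQ.2
      subst hℓm
      have hPQ : P = Q := (h'.subset (Or.inl rfl)).resolve_right hP
      subst hPQ
      rfl
    · rintro ⟨S, hS⟩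
      obtain ⟨ℓ, P, hP, rfl⟩ := mem_linesWithPoint_iff.1 hS
      exact ⟨⟨ℓ, P, hP⟩, rfl⟩
  have hfib : ∀ ℓ : Plane K, Nat.card {P // P ∉ pts ℓ} = Fintype.card K ^ 2 := fun ℓ => by
    have h1 := ncard_compl_eq (pts ℓ)
    rw [ncard_pts] at h1
    change Nat.card ((pts ℓ)ᶜ : Set (Plane K)) = _
    rw [Nat.card_coe_set_eq]
    omega
  rw [← Nat.card_coe_set_eq, ← Nat.card_congr (Equiv.ofBijective g hg), Nat.card_sigma]
  simp_rw [hfib]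
  rw [Finset.sum_const, smul_eq_mul, Finset.card_univ, ← Nat.card_eq_fintype_card, natCard_plane]

/-- By duality, unordered pairs of lines are two-element sets of dual points. The union determines
the pair, since a third line meets it in at most two points but has at least three. -/
theorem ncard_linePairs : (linePairs K).ncard = (pointSets K 2).ncard := by
  have hq := Fintype.one_lt_card (α := K)
  have key : ∀ {ℓ m n : Plane K}, pts ℓ ⊆ pts m ∪ pts n → ℓ = m ∨ ℓ = n := by
    intro ℓ m n hsub
    by_contra! hne
    obtain ⟨P, hP, hP'⟩ := exists_meet hne.1
    obtain ⟨Q, hQ, hQ'⟩ := exists_meet hne.2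
    obtain ⟨R, hR, hRPQ⟩ := exists_mem_pts_notMem ℓ (S := {P, Q})
      ((ncard_pair_le P Q).trans (by omega))
    simp only [Set.mem_insert_iff, Set.mem_singleton_iff, not_or] at hRPQ
    rcases hsub hR with h | h
    · exact (eq_or_eq_of_mem_pts hR hP h hP').elim hRPQ.1 hne.1
    · exact (eq_or_eq_of_mem_pts hR hQ h hQ').elim hRPQ.2 hne.2
  have h : linePairs K = (fun T : Set (Plane K) => ⋃ ℓ ∈ T, pts ℓ) '' pointSets K 2 := by
    ext S
    rw [mem_linePairs_iff]
    constructor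
    · rintro ⟨ℓ, m, hne, rfl⟩
      exact ⟨{ℓ, m}, Set.ncard_pair hne, by simp⟩
    · rintro ⟨T, hT, rfl⟩
      obtain ⟨ℓ, m, hne, rfl⟩ := Set.ncard_eq_two.1 hT
      exact ⟨ℓ, m, hne, by simp⟩
  rw [h, Set.InjOn.ncard_image]
  have hle : ∀ T ∈ pointSets K 2, ∀ T' ∈ pointSets K 2,
      (⋃ ℓ ∈ T, pts ℓ) = (⋃ ℓ ∈ T', pts ℓ) → T ⊆ T' := by
    intro T _ T' hT' hTT' ℓ hℓ
    obtain ⟨m, n, -, rfl⟩ := Set.ncard_eq_two.1 hT'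
    have hsub : pts ℓ ⊆ pts m ∪ pts n := by
      have := (Set.subset_biUnion_of_mem (u := pts) hℓ).trans hTT'.subset
      simpa using this
    exact key hsub
  exact fun T hT T' hT' hTT' => (hle T hT T' hT' hTT').antisymm (hle T' hT' T hT hTT'.symm)

end Counts
-- Counting irreducible conics
section CountIrreducible

variable {K : Type*} [Field K]

theorem disjoint_flats {i j : ℕ} (hij : i ≠ j) {S : Set (Plane K)} (hi : S ∈ flats K i) :
    S ∉ flats K j := fun hj => hij (hi.2.symm.trans hj.2)

variable [Fintype K]

theorem ncard_pts_union_pts {ℓ m : Plane K} (h : ℓ ≠ m) :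
    (pts ℓ ∪ pts m).ncard = 2 * Fintype.card K + 1 := by
  obtain ⟨O, hO, hO'⟩ := exists_meet h
  have h1 : pts ℓ ∩ pts m = {O} := by
    ext X
    refine ⟨fun hX => (eq_or_eq_of_mem_pts hX.1 hO hX.2 hO').resolve_right h, ?_⟩
    rintro rfl
    exact ⟨hO, hO'⟩
  have h2 := Set.ncard_union_add_ncard_inter (pts ℓ) (pts m)
  rw [h1, Set.ncard_singleton, ncard_pts, ncard_pts] at h2
  omega

theorem ncard_fiber_of_multiples {a : Fin 6 → K} (ha : a ≠ 0)
    (h : ∀ b, b ≠ 0 → zeros b = zeros a → ∃ c : K, c • a = b) :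
    {b | b ≠ 0 ∧ zeros b = zeros a}.ncard = Fintype.card K - 1 := by
  classical
  have heq : {b | b ≠ 0 ∧ zeros b = zeros a} = (fun c : Kˣ => (c : K) • a) '' Set.univ := by
    ext b
    constructor
    · rintro ⟨hb, hz⟩
      obtain ⟨c, rfl⟩ := h b hb hz
      have hc : c ≠ 0 := by
        rintro rfl
        exact hb (zero_smul K a)
      exact ⟨Units.mk0 c hc, trivial, rfl⟩
    · rintro ⟨c, -, rfl⟩
      exact ⟨smul_ne_zero c.ne_zero ha, zeros_smul c.ne_zero a⟩
  rw [heq, Set.ncard_image_of_injective, Set.ncard_univ, Nat.card_eq_fintype_card,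
    Fintype.card_units]
  exact fun c d hcd => Units.ext (smul_left_injective K ha hcd)

/-- The forms with zero set `S` are the nonzero elements of a one-dimensional space. -/
theorem ncard_fiber_of_mem_flats_one {S : Set (Plane K)} (hS : S ∈ flats K 1) :
    {b | b ≠ 0 ∧ zeros b = S}.ncard = Fintype.card K - 1 := by
  obtain ⟨a, ha, rfl⟩ := exists_zeros_of_mem_flats hS
  refine ncard_fiber_of_multiples ha fun b _ hz => ?_
  have h1 : Module.finrank K (vanishing (zeros a)) = 1 := hS.2
  obtain ⟨c, hc⟩ := (finrank_eq_one_iff_of_nonzero'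
    (⟨a, mem_vanishing.2 subset_rfl⟩ : vanishing (zeros a))
    (fun h => ha (congrArg Subtype.val h))).1 h1 ⟨b, mem_vanishing.2 hz.symm.subset⟩
  exact ⟨c, congrArg Subtype.val hc⟩

/-- The forms vanishing on a line have dimension 3, but one with no further zeros must have the same
line as its second factor, so only multiples of the square remain. -/
theorem ncard_fiber_of_mem_lines {S : Set (Plane K)} (hS : S ∈ lines K) :
    {b | b ≠ 0 ∧ zeros b = S}.ncard = Fintype.card K - 1 := by
  obtain ⟨ℓ, rfl⟩ := mem_lines_iff.1 hS
  have hz : zeros (lineMul ℓ.rep ℓ.rep) = pts ℓ := by rw [zeros_lineMul, Set.union_self]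
  rw [← hz]
  refine ncard_fiber_of_multiples
    (fun h => ℓ.rep_nonzero (eq_zero_of_lineMul_eq_zero ℓ.rep_nonzero h)) fun b hb hzb => ?_
  rw [hz] at hzb
  obtain ⟨m, c, hc, rfl⟩ := exists_eq_smul_lineMul hb hzb.symm.subset
  rw [zeros_smul hc, zeros_lineMul] at hzb
  have hm : pts m = pts ℓ := Set.eq_of_subset_of_ncard_le
    (Set.subset_union_right.trans hzb.subset) (by rw [ncard_pts, ncard_pts])
  rw [pts_injective hm]
  exact ⟨c, rfl⟩

theorem ncard_preimage_of_fibers {α β : Type*} [Finite α] [Finite β] (f : α → β) (p : α → Prop)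
    {C : Set β} {k : ℕ} (h : ∀ b ∈ C, {a | p a ∧ f a = b}.ncard = k) :
    {a | p a ∧ f a ∈ C}.ncard = k * C.ncard := by
  classical
  have := Fintype.ofFinite β
  let g : {a | p a ∧ f a ∈ C} ≃ Σ b : C, {a | p a ∧ f a = b.1} :=
    { toFun := fun a => ⟨⟨f a, a.2.2⟩, a, a.2.1, rfl⟩
      invFun := fun x => ⟨x.2, x.2.2.1, x.2.2.2.symm ▸ x.1.2⟩
      left_inv := fun a => rfl
      right_inv := fun ⟨⟨b, hb⟩, ⟨a, ha, hab⟩⟩ => Sigma.subtype_ext (Subtype.ext hab) rfl }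
  rw [← Nat.card_coe_set_eq, Nat.card_congr g, Nat.card_sigma]
  have h' : ∀ b : C, Nat.card {a | p a ∧ f a = b.1} = k := fun b => by
    rw [Nat.card_coe_set_eq, h b.1 b.2]
  simp_rw [h', Finset.sum_const, smul_eq_mul, Finset.card_univ, ← Nat.card_eq_fintype_card,
    Nat.card_coe_set_eq]
  rw [mul_comm]

theorem ncard_forms_through (P : Plane K) :
    {a : Fin 6 → K | P ∈ zeros a}.ncard = Fintype.card K ^ 5 := by
  have h5 : Module.finrank K (vanishing {P}) = 5 := by
    have h : {P} ∈ flats K 5 := by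
      rw [flats_five]
      exact Set.ncard_singleton P
    exact h.2
  have h : {a : Fin 6 → K | P ∈ zeros a} = (vanishing {P} : Set (Fin 6 → K)) := by
    ext a
    rw [SetLike.mem_coe, mem_vanishing, Set.singleton_subset_iff]
    rfl
  rw [h, ← Nat.card_coe_set_eq, ← h5, ← Nat.card_eq_fintype_card (α := K)]
  exact Module.natCard_eq_pow_finrank

/-- Double counting of pairs of a form and a zero of it: passing through a given point is one linear
condition on six coefficients. -/
theorem sum_ncard_zeros : ∑ a : Fin 6 → K, (zeros a).ncard =
    (Fintype.card K ^ 2 + Fintype.card K + 1) * Fintype.card K ^ 5 := by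
  classical
  have := Fintype.ofFinite (Plane K)
  have h1 : ∀ a : Fin 6 → K, (zeros a).ncard = ∑ P : Plane K, if P ∈ zeros a then 1 else 0 :=
    fun a => by
      rw [Finset.sum_boole, Nat.cast_id, Set.ncard_eq_toFinset_card']
      congr 1
      ext P
      simp
  have h2 : ∀ P : Plane K, (∑ a : Fin 6 → K, if P ∈ zeros a then 1 else 0) =
      Fintype.card K ^ 5 := fun P => by
    rw [← ncard_forms_through P, Finset.sum_boole, Nat.cast_id, Set.ncard_eq_toFinset_card']
    congr 1
    ext a
    simp
  simp_rw [h1]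
  rw [Finset.sum_comm]
  simp_rw [h2]
  rw [Finset.sum_const, smul_eq_mul, Finset.card_univ, ← Nat.card_eq_fintype_card, natCard_plane]

/-- Sum the number of zeros minus one over all forms. Subtracting one removes the one-point conics,
whose number is not known beforehand. The remaining contributions are `q` for irreducible conics and
double lines, `2 * q` for line pairs and `q ^ 2 + q` for the zero form, and only the number of
irreducible conics is unknown. -/
theorem ncard_irreducibleConics (hq : 4 ≤ Fintype.card K) :
    ((irreducibleConics K).ncard : ℤ) = Fintype.card K ^ 5 - Fintype.card K ^ 2 := by
  classical
  set q := Fintype.card K with hqdef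
  have hlines : lines K ⊆ flats K 3 := by
    rw [flats_three]
    exact Set.subset_union_left
  have hsum : ∀ C : Set (Set (Plane K)),
      (∀ S ∈ C, {a : Fin 6 → K | a ≠ 0 ∧ zeros a = S}.ncard = q - 1) →
      (∑ a : Fin 6 → K, if a ≠ 0 ∧ zeros a ∈ C then (1 : ℤ) else 0) = (q - 1) * C.ncard := by
    intro C hC
    have h := ncard_preimage_of_fibers zeros (· ≠ 0) hC
    rw [Set.ncard_eq_toFinset_card'] at h
    rw [Finset.sum_boole, ← Nat.cast_one, ← Nat.cast_sub (by omega), ← Nat.cast_mul, ← h]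
    congr 2
    ext a
    simp
  have hI := hsum (irreducibleConics K)
    fun S hS => ncard_fiber_of_mem_flats_one (irreducibleConics_subset_flats hq hS)
  have hP := hsum (linePairs K)
    fun S hS => ncard_fiber_of_mem_flats_one (linePairs_subset_flats hS)
  have hL := hsum (lines K) fun S hS => ncard_fiber_of_mem_lines hS
  have hpoint : ∀ a : Fin 6 → K, ((zeros a).ncard : ℤ) - 1 =
      q * (if a ≠ 0 ∧ zeros a ∈ irreducibleConics K then 1 else 0) +
      2 * q * (if a ≠ 0 ∧ zeros a ∈ linePairs K then 1 else 0) +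
      q * (if a ≠ 0 ∧ zeros a ∈ lines K then 1 else 0) +
      (q ^ 2 + q) * (if a = 0 then 1 else 0) := by
    intro a
    by_cases ha : a = 0
    · have hz : zeros a = Set.univ := by
        ext P
        simp [mem_zeros, ha, qf]
      rw [hz, Set.ncard_univ, natCard_plane]
      simp [ha, q]
    · have hIL : zeros a ∈ irreducibleConics K → zeros a ∉ lines K := fun h1 h2 =>
        disjoint_flats (by norm_num) (irreducibleConics_subset_flats hq h1) (hlines h2)
      have hPL : zeros a ∈ linePairs K → zeros a ∉ lines K := fun h1 h2 =>
        disjoint_flats (by norm_num) (linePairs_subset_flats h1) (hlines h2)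
      have hIP : zeros a ∈ irreducibleConics K → zeros a ∉ linePairs K := fun h1 h2 => by
        obtain ⟨b, hb, hab⟩ := mem_irreducibleConics_iff.1 h1
        obtain ⟨ℓ, m, -, h⟩ := mem_linePairs_iff.1 h2
        refine not_isIrred_of_pts_subset (ℓ := ℓ) ?_ hb
        rw [← hab, h]
        exact Set.subset_union_left
      by_cases h1 : zeros a ∈ irreducibleConics K
      · obtain ⟨b, hb, hab⟩ := mem_irreducibleConics_iff.1 h1
        have hcard := ncard_zeros_of_isIrred hb
        rw [← hab] at hcard
        simp [ha, h1, hIL h1, hIP h1, hcard, q]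
      by_cases h2 : zeros a ∈ linePairs K
      · obtain ⟨ℓ, m, hne, h⟩ := mem_linePairs_iff.1 h2
        have hcard := ncard_pts_union_pts hne
        rw [← h] at hcard
        simp [ha, h1, h2, hPL h2, hcard, q]
      by_cases h3 : zeros a ∈ lines K
      · obtain ⟨ℓ, h⟩ := mem_lines_iff.1 h3
        have hcard := ncard_pts ℓ
        rw [← h] at hcard
        simp [ha, h1, h2, h3, hcard, q]
      · have h4 : (zeros a).ncard = 1 := by
          have := zeros_cases ha
          tauto
        simp [ha, h1, h2, h3, h4]
  have htot := Finset.sum_congr (rfl : (Finset.univ : Finset (Fin 6 → K)) = Finset.univ)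
    fun a _ => hpoint a
  simp only [Finset.sum_add_distrib, Finset.sum_sub_distrib, ← Finset.mul_sum] at htot
  rw [hI, hP, hL, ← Nat.cast_sum, sum_ncard_zeros, ncard_linePairs, ncard_lines] at htot
  have htwo := two_mul_ncard_pointSets_two (K := K)
  rw [← hqdef] at htot htwo
  simp at htot
  rw [← hqdef] at htot
  have htwo' : 2 * ((pointSets K 2).ncard : ℤ) = (q ^ 2 + q) * (q ^ 2 + q + 1) := by
    exact_mod_cast htwo
  have hq' : (4 : ℤ) ≤ q := by exact_mod_cast hq
  have hne : (q : ℤ) * (q - 1) ≠ 0 := mul_ne_zero (by omega) (by omega)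
  apply mul_left_cancel₀ hne
  linear_combination -htot - (q : ℤ) * (q - 1) * htwo'

end CountIrreducible
-- Nullity in the column matroid as a dimension of quadratic forms
section Nullity

theorem columnMatroid_indep {K : Type*} [Field K] {r E : Type*} [Finite E] (H : Matrix r E K)
    (I : Set E) : (columnMatroid H).Indep I ↔ LinearIndepOn K (fun (e : E) (i : r) => H i e) I := by
  simp [columnMatroid]

/-- The rank of a set in the column matroid is the dimension of the span of the columns. -/
theorem eRk_columnMatroid {K : Type*} [Field K] {r E : Type*} [Finite E] (H : Matrix r E K)
    (X : Set E) : ((columnMatroid H).eRk X).toNat =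
      Module.finrank K (Submodule.span K (Set.range fun (e : X) (i : r) => H i e)) := by
  classical
  obtain ⟨I, hI⟩ := (columnMatroid H).exists_isBasis X (Set.subset_univ X)
  have := Fintype.ofFinite I
  have hind := (columnMatroid_indep H I).1 hI.indep
  have hspan : Submodule.span K (Set.range fun (e : X) (i : r) => H i e) =
      Submodule.span K (Set.range fun (e : I) (i : r) => H i e) := by
    apply le_antisymm
    · rw [Submodule.span_le]
      rintro _ ⟨⟨e, he⟩, rfl⟩
      by_cases heI : e ∈ I
      · exact Submodule.subset_span ⟨⟨e, heI⟩, rfl⟩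
      · by_contra hns
        apply heI
        refine hI.mem_of_insert_indep he ((columnMatroid_indep H _).2 (hind.insert ?_))
        rwa [Set.image_eq_range]
    · apply Submodule.span_mono
      rintro _ ⟨⟨e, he⟩, rfl⟩
      exact ⟨⟨e, hI.subset he⟩, rfl⟩
  rw [hspan, finrank_span_eq_card hind, ← hI.encard_eq_eRk, ← Nat.card_eq_fintype_card,
    Nat.card_coe_set_eq]
  rfl

/-- The nullity of a set in the column matroid is the dimension of the space of linear relations
between the columns. -/
theorem nullity_columnMatroid {K : Type*} [Field K] {r E : Type*} [Finite E] (H : Matrix r E K)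
    (X : Set E) [Fintype X] : nullity (columnMatroid H) X =
      Module.finrank K
        (LinearMap.ker (Fintype.linearCombination K fun (e : X) (i : r) => H i e)) := by
  have h := LinearMap.finrank_range_add_finrank_ker
    (Fintype.linearCombination K fun (e : X) (i : r) => H i e)
  rw [Fintype.range_linearCombination, Module.finrank_fintype_fun_eq_card,
    ← Nat.card_eq_fintype_card, Nat.card_coe_set_eq] at h
  rw [nullity, eRk_columnMatroid]
  omega

variable {K : Type*} [Field K]

theorem eq_zero_of_zeros_eq_univ {a : Fin 6 → K} (h : ∀ P, P ∈ zeros a) : a = 0 := by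
  refine eq_of_forall_qf_eq fun v => ?_
  rw [show qf (0 : Fin 6 → K) v = 0 by simp [qf]]
  by_cases hv : v = 0
  · simp [hv, qf_eq]
  · obtain ⟨c, hc⟩ := (mk_eq_iff_exists hv _).1 rfl
    rw [← hc, qf_smul, mem_zeros.1 (h _), mul_zero]

theorem vecMul_eq_zero_iff {G : Matrix (Fin 6) (Plane K) K} (hG : IsVeroneseMatrix G)
    (a : Fin 6 → K) (P : Plane K) : Matrix.vecMul a G P = 0 ↔ P ∈ zeros a := by
  obtain ⟨c, hc, h⟩ := hG P
  have : Matrix.vecMul a G P = c * qf a P.rep := by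
    change a ⬝ᵥ (fun i => G i P) = _
    rw [h, dotProduct_smul, smul_eq_mul, qf]
  rw [this, mul_eq_zero, or_iff_right hc, mem_zeros]

theorem mem_codeOf_iff {E : Type*} (G : Matrix (Fin 6) E K) (c : E → K) :
    c ∈ codeOf G ↔ ∃ a, Matrix.vecMul a G = c := by
  rw [codeOf, Submodule.mem_span_range_iff_exists_fun]
  simp_rw [Matrix.vecMul_eq_sum]

/-- The nullity of a set in the Veronese matroid is the dimension of the space of quadratic forms
vanishing on its complement. -/
theorem nullity_eq_dimVan [Fintype (Plane K)] {G : Matrix (Fin 6) (Plane K) K}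
    (hG : IsVeroneseMatrix G) {m : ℕ} {H : Matrix (Fin m) (Plane K) K}
    (hH : IsParityCheck H (codeOf G)) (X : Set (Plane K)) :
    nullity (columnMatroid H) X = dimVan Xᶜ := by
  classical
  have hmul : ∀ c : Plane K → K, (∀ e ∉ X, c e = 0) →
      Fintype.linearCombination K (fun (e : X) (i : Fin m) => H i e) (fun e : X => c e) =
        H.mulVec c := by
    intro c hc
    ext i
    rw [Fintype.linearCombination_apply, Finset.sum_apply, Matrix.mulVec, dotProduct,
      ← Finset.sum_subset (Finset.subset_univ X.toFinset)
        (fun e _ he => by rw [hc e (by simpa using he), mul_zero]),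
      Finset.sum_subtype X.toFinset (fun e => Set.mem_toFinset) (fun e => H i e * c e)]
    exact Finset.sum_congr rfl fun e _ => mul_comm _ _
  have hvan : ∀ a ∈ vanishing Xᶜ, ∀ e ∉ X, Matrix.vecMul a G e = 0 := fun a ha e he =>
    (vecMul_eq_zero_iff hG a e).2 (mem_vanishing.1 ha he)
  let g : vanishing Xᶜ →ₗ[K] (X → K) :=
    { toFun := fun a e => Matrix.vecMul a.1 G e
      map_add' := fun a b => by
        ext e
        simp [Matrix.add_vecMul]
      map_smul' := fun c a => by
        ext e
        simp [Matrix.smul_vecMul] }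
  -- A form in the kernel vanishes on `X` and, by assumption, on the complement, hence at every
  -- point.
  have hg : Function.Injective g := by
    rw [← LinearMap.ker_eq_bot, LinearMap.ker_eq_bot']
    rintro ⟨a, ha⟩ h0
    refine Subtype.ext (eq_zero_of_zeros_eq_univ fun P => ?_)
    by_cases hP : P ∈ X
    · exact (vecMul_eq_zero_iff hG a P).1 (congrFun h0 ⟨P, hP⟩)
    · exact mem_vanishing.1 ha hP
  have hrange : LinearMap.range g =
      LinearMap.ker (Fintype.linearCombination K fun (e : X) (i : Fin m) => H i e) := by
    ext c
    rw [LinearMap.mem_ker]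
    constructor
    · rintro ⟨⟨a, ha⟩, rfl⟩
      exact (hmul (Matrix.vecMul a G) (hvan a ha)).trans
        ((hH _).1 ((mem_codeOf_iff G _).2 ⟨a, rfl⟩))
    · intro hc
      -- The relation extended by zero is killed by `H`, hence is the codeword of a form, which
      -- vanishes wherever the extension is zero.
      let c' : Plane K → K := fun e => if he : e ∈ X then c ⟨e, he⟩ else 0
      have hc' : ∀ e ∉ X, c' e = 0 := fun e he => dif_neg he
      have hcc' : (fun e : X => c' e) = c := by
        ext e
        exact dif_pos e.2
      have h := hmul c' hc'
      rw [hcc', hc] at h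
      obtain ⟨a, ha⟩ := (mem_codeOf_iff G c').1 ((hH c').2 h.symm)
      refine ⟨⟨a, fun P hP => ?_⟩, ?_⟩
      · rw [← mem_zeros, ← vecMul_eq_zero_iff hG, ha]
        exact hc' P hP
      · ext e
        exact (congrFun ha e.1).trans (dif_pos e.2)
  rw [nullity_columnMatroid, ← hrange, LinearMap.finrank_range_of_inj hg, dimVan]

theorem mem_nullityClass_iff [Fintype (Plane K)] {G : Matrix (Fin 6) (Plane K) K}
    (hG : IsVeroneseMatrix G) {m : ℕ} {H : Matrix (Fin m) (Plane K) K}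
    (hH : IsParityCheck H (codeOf G)) {i : ℕ} {X : Set (Plane K)} :
    X ∈ nullityClass (columnMatroid H) i ↔ dimVan Xᶜ = i := by
  rw [← nullity_eq_dimVan hG hH]
  exact and_iff_right (Set.subset_univ X)

/-- The minimal sets of given nullity are the complements of the flats of the Veronese points. -/
theorem minimalNullitySets_eq [Fintype (Plane K)] {G : Matrix (Fin 6) (Plane K) K}
    (hG : IsVeroneseMatrix G) {m : ℕ} {H : Matrix (Fin m) (Plane K) K}
    (hH : IsParityCheck H (codeOf G)) (i : ℕ) :
    minimalNullitySets (columnMatroid H) i = compl '' flats K i := by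
  ext X
  rw [Set.mem_compl_image]
  constructor
  · rintro ⟨hX, hmin⟩
    simp only [mem_nullityClass_iff hG hH] at hX hmin
    refine ⟨(subset_hull _).antisymm' ?_, hX⟩
    -- The complement of the hull is a subset of `X` with the same nullity, so minimality forces the
    -- complement of `X` to be closed.
    have h := hmin (y := (hull Xᶜ)ᶜ) (by rw [compl_compl, dimVan_hull, hX])
      (Set.compl_subset_comm.1 (subset_hull _))
    exact Set.subset_compl_comm.1 h
  · rintro ⟨hflat, hX⟩
    refine ⟨(mem_nullityClass_iff hG hH).2 hX, fun Y hY hYX => ?_⟩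
    replace hY := (mem_nullityClass_iff hG hH).1 hY
    have hsub : Xᶜ ⊆ Yᶜ := Set.compl_subset_compl.2 hYX
    have heq : vanishing Yᶜ = vanishing Xᶜ :=
      Submodule.eq_of_le_of_finrank_eq (vanishing_anti hsub) (hY.trans hX.symm)
    rw [← Set.compl_subset_compl]
    calc Yᶜ ⊆ hull Yᶜ := subset_hull _
      _ = hull Xᶜ := by rw [hull, heq, hull]
      _ = Xᶜ := hflat

theorem nullityClass_six [Fintype (Plane K)] {G : Matrix (Fin 6) (Plane K) K}
    (hG : IsVeroneseMatrix G) {m : ℕ} {H : Matrix (Fin m) (Plane K) K}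
    (hH : IsParityCheck H (codeOf G)) :
    nullityClass (columnMatroid H) 6 = {Set.univ} := by
  ext X
  rw [mem_nullityClass_iff hG hH, Set.mem_singleton_iff, ← Set.compl_empty_iff]
  constructor
  · intro h
    rw [Set.eq_empty_iff_forall_notMem]
    intro P hP
    have h1 := eq_hull_of_subset (hull_hull Xᶜ) (Set.empty_subset _)
      (by rw [dimVan_empty, dimVan_hull, h])
    rw [hull_empty] at h1
    exact h1.symm.subset (subset_hull _ hP)
  · intro h
    rw [h, dimVan_empty]

end Nullity

end Veronese

/-- For the parity check matroid of the Veronese code over a field with `q ≥ 4` elements, the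
minimal sets of nullity `1, …, 6` are the complements of the listed point configurations of the
projective plane, whose numbers are as given. -/
theorem theorem3p4 {K : Type*} [Field K] [Fintype K] [Fintype (ℙ K (Fin 3 → K))]
    (q : ℕ) (hq : Fintype.card K = q) (hq4 : 4 ≤ q)
    (G : Matrix (Fin 6) (ℙ K (Fin 3 → K)) K) (hG : Veronese.IsVeroneseMatrix G)
    {m : ℕ} (H : Matrix (Fin m) (ℙ K (Fin 3 → K)) K)
    (hH : Veronese.IsParityCheck H (Veronese.codeOf G)) :
    (Veronese.minimalNullitySets (Veronese.columnMatroid H) 1 =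
          compl '' (Veronese.linePairs K ∪ Veronese.irreducibleConics K) ∧
        ((Veronese.linePairs K).ncard : ℚ) = q * (q + 1) * (q ^ 2 + q + 1) / 2 ∧
        ((Veronese.irreducibleConics K).ncard : ℚ) = q ^ 5 - q ^ 2) ∧
      (Veronese.minimalNullitySets (Veronese.columnMatroid H) 2 =
          compl '' (Veronese.linesWithPoint K ∪ Veronese.quadrilaterals K) ∧
        ((Veronese.linesWithPoint K).ncard : ℚ) = q ^ 2 * (q ^ 2 + q + 1) ∧
        ((Veronese.quadrilaterals K).ncard : ℚ) =
          (q ^ 2 + q + 1) * q ^ 2 * (q ^ 2 + q) * (q - 1) ^ 2 / 24) ∧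
      (Veronese.minimalNullitySets (Veronese.columnMatroid H) 3 =
          compl '' (Veronese.lines K ∪ Veronese.triangles K) ∧
        ((Veronese.lines K).ncard : ℚ) = q ^ 2 + q + 1 ∧
        ((Veronese.triangles K).ncard : ℚ) = (q ^ 2 + q + 1) * q ^ 2 * (q ^ 2 + q) / 6) ∧
      (Veronese.minimalNullitySets (Veronese.columnMatroid H) 4 =
          compl '' Veronese.pointSets K 2 ∧
        ((Veronese.pointSets K 2).ncard : ℚ) = (q ^ 2 + q + 1) * (q ^ 2 + q) / 2) ∧
      (Veronese.minimalNullitySets (Veronese.columnMatroid H) 5 =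
          compl '' Veronese.pointSets K 1 ∧
        ((Veronese.pointSets K 1).ncard : ℚ) = q ^ 2 + q + 1) ∧
      Veronese.nullityClass (Veronese.columnMatroid H) 6 = {Set.univ} := by
  subst hq
  have hI : ((Veronese.irreducibleConics K).ncard : ℚ) =
      Fintype.card K ^ 5 - Fintype.card K ^ 2 := by
    exact_mod_cast Veronese.ncard_irreducibleConics hq4
  have hP : 2 * ((Veronese.pointSets K 2).ncard : ℚ) = (Fintype.card K ^ 2 + Fintype.card K) *
      (Fintype.card K ^ 2 + Fintype.card K + 1) := by
    exact_mod_cast Veronese.two_mul_ncard_pointSets_two (K := K)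
  have hT : 3 * ((Veronese.triangles K).ncard : ℚ) =
      Fintype.card K ^ 2 * (Veronese.pointSets K 2).ncard := by
    exact_mod_cast Veronese.three_mul_ncard_triangles (K := K)
  have hQ : 4 * ((Veronese.quadrilaterals K).ncard : ℚ) =
      (Fintype.card K - 1) ^ 2 * (Veronese.triangles K).ncard := by
    have h := congrArg (Nat.cast (R := ℚ)) (Veronese.four_mul_ncard_quadrilaterals (K := K))
    -- The natural subtraction in `q - 1` does not truncate, so it passes to the rationals.
    push_cast [Nat.cast_sub (show 1 ≤ Fintype.card K by omega)] at h
    exact h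
  simp only [Veronese.minimalNullitySets_eq hG hH, Veronese.flats_one hq4, Veronese.flats_two,
    Veronese.flats_three, Veronese.flats_four, Veronese.flats_five, Veronese.ncard_linePairs,
    Veronese.ncard_linesWithPoint, Veronese.ncard_lines, Veronese.ncard_pointSets_one,
    Veronese.nullityClass_six hG hH, hI, true_and, and_true]
  refine ⟨?_, ⟨?_, ?_⟩, ⟨?_, ?_⟩, ?_, ?_⟩
  · linear_combination hP / 2
  · push_cast
    ring
  · linear_combination hQ / 4 + (Fintype.card K - 1 : ℚ) ^ 2 * hT / 12 +
      (Fintype.card K - 1 : ℚ) ^ 2 * Fintype.card K ^ 2 * hP / 24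
  · push_cast
    ring
  · linear_combination hT / 3 + (Fintype.card K : ℚ) ^ 2 * hP / 6
  · linear_combination hP / 2
  · push_cast
    ring
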